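/- Let $n\ge 1$, let $g$ be a smooth Riemannian metric on $\mathbf R^n$, let $a=(a_1,\dots,a_n)$, $c>0$ and $q\ge 0$ be smooth and real valued, and assume that $g$ is Euclidean, $c=1$, $a=0$ and $q=0$ outside a compact set. Put $D_j=-\mathrm i\,\partial/\partial x^j+a_j$, $\mathrm{dVol}=(\det g)^{1/2}\,dx$, $|Du|^2=g^{ij}(D_iu)\overline{(D_ju)}$ and $$P=c^2(\det g)^{-1/2}\,D_i\,g^{ij}(\det g)^{1/2}D_j+q .$$ Let $\Omega\subset\mathbf R^n$ be a bounded domain with smooth boundary and let $T>0$ (no non-trapping assumption is made). For an open set $U$ let $H_D(U)$ be the closure of $C_0^\infty(U)$ in the complex-valued Sobolev space $H^1(U)$. On $H^1(\Omega)$ put $\|f\|_{H_D(\Omega)}^2=\int_\Omega(|Df|^2+c^{-2}q|f|^2)\,\mathrm{dVol}$ (on $H_D(\Omega)$ this is a norm equivalent to the $H^1$ norm, so $H_D(\Omega)$ is the completion of $C_0^\infty(\Omega)$ in it), and let $$E_\Omega(u,t)=\int_\Omega\big(|Du|^2+c^{-2}q|u|^2+c^{-2}|u_t|^2\big)(t,\cdot)\,\mathrm{dVol}.$$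 Solutions of the wave equation $(\partial_t^2+P)u=0$ in $(0,T)\times U$ are weak solutions in $C([0,T];H^1(U))\cap C^1([0,T];L^2(U))$, equations for $P$ are understood weakly, and $H^1(\Omega)$ functions have the same boundary values on $\partial\Omega$ when their difference lies in $H_D(\Omega)$. Let $f\in H_D(\Omega)$, $f\ne0$. Then there is exactly one solution $u$, with values in $H_D(\mathbf R^n)$, of $$(\partial_t^2+P)u=0\ \text{ in }(0,T)\times\mathbf R^n,\qquad u|_{t=0}=f,\quad \partial_tu|_{t=0}=0,$$ where $f$ is extended by $0$ outside $\Omega$. Set $\Lambda f=u|_{[0,T]\times\partial\Omega}$. For $h=\Lambda f$ there is exactly one solution $v$ of $$(\partial_t^2+P)v=0\ \text{ in }(0,T)\times\Omega,\qquad v|_{[0,T]\times\partial\Omega}=h,\quad v|_{t=T}=\phi,\quad \partial_tv|_{t=T}=0,$$ where $P\phi=0$ in $\Omega$ and $\phi|_{\partial\Omega}=h(T,\cdot)$. Set $Ah=v(0,\cdot)$. Then $f-A\Lambda f\in H_D(\Omega)$, $E_\Omega(u,0)>0$, and $$\|f-A\Lambda f\|_{H_D(\Omega)}\le\left(\frac{E_\Omega(u,T)}{E_\Omega(u,0)}\right)^{1/2}\|f\|_{H_D(\Omega)}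 .$$ -/

import Mathlib

open MeasureTheory Set Filter Topology
open scoped ContDiff ENNReal ComplexConjugate

noncomputable section

namespace Thermoacoustic

/-- Euclidean space `ℝⁿ`. -/
abbrev E (n : ℕ) : Type := EuclideanSpace ℝ (Fin n)

/-- The coefficients of the operator `P` on `ℝⁿ`: a Riemannian metric `g`, a real magnetic potential
`a` (with components `a_i`), a sound speed `c > 0` and a potential `q ≥ 0`, all smooth, with `g`
Euclidean, `c = 1`, `q = 0`, `a = 0` outside a compact set. -/
structure Medium (n : ℕ) where
  g : E n → Matrix (Fin n) (Fin n) ℝ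
  a : E n → Fin n → ℝ
  c : E n → ℝ
  q : E n → ℝ
  g_smooth : ∀ i j, ContDiff ℝ ∞ (fun x => g x i j)
  a_smooth : ∀ j, ContDiff ℝ ∞ (fun x => a x j)
  c_smooth : ContDiff ℝ ∞ c
  q_smooth : ContDiff ℝ ∞ q
  g_posDef : ∀ x, (g x).PosDef
  c_pos : ∀ x, 0 < c x
  q_nonneg : ∀ x, 0 ≤ q x
  trivial_outside : ∃ K : Set (E n), IsCompact K ∧
    ∀ x, x ∉ K → g x = 1 ∧ a x = 0 ∧ c x = 1 ∧ q x = 0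

/-- A smooth bounded domain: open, connected, bounded, and locally near each boundary point of
the form `{ρ < 0}` with `ρ` smooth and `dρ ≠ 0`. -/
structure IsSmoothBoundedDomain {n : ℕ} (Ω : Set (E n)) : Prop where
  isOpen : IsOpen Ω
  isConnected : IsConnected Ω
  isBounded : Bornology.IsBounded Ω
  smooth_boundary : ∀ p ∈ frontier Ω, ∃ W : Set (E n), IsOpen W ∧ p ∈ W ∧
    ∃ ρ : E n → ℝ, ContDiff ℝ ∞ ρ ∧ fderiv ℝ ρ p ≠ 0 ∧ Ω ∩ W = {x ∈ W | ρ x < 0}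

/-! ### Sobolev spaces -/

/-- Complex test functions `C_0^∞(U)`. -/
structure IsTestFunction {n : ℕ} (U : Set (E n)) (η : E n → ℂ) : Prop where
  smooth : ContDiff ℝ ∞ η
  compact : HasCompactSupport η
  supp : tsupport η ⊆ U

/-- The classical partial derivative `∂η/∂x^j`. -/
def pderiv {n : ℕ} (j : Fin n) (η : E n → ℂ) (x : E n) : ℂ :=
  fderiv ℝ η x (EuclideanSpace.single j 1)

/-- `L²(U)`. -/
abbrev L2 {n : ℕ} (U : Set (E n)) : Type := Lp ℂ 2 (volume.restrict U)

/-- `G` is the weak derivative `∂u/∂x^j` on `U`. -/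
def IsWeakDeriv {n : ℕ} (U : Set (E n)) (j : Fin n) (u G : L2 U) : Prop :=
  ∀ η : E n → ℂ, IsTestFunction U η →
    ∫ x in U, u x * pderiv j η x = - ∫ x in U, G x * η x

theorem integrable_mul_of_compact {n : ℕ} {U : Set (E n)} (u : L2 U) {η : E n → ℂ}
    (hc : Continuous η) (hs : HasCompactSupport η) :
    Integrable (fun x => u x * η x) (volume.restrict U) :=
  MemLp.integrable_mul (p := 2) (q := 2) (Lp.memLp u) (hc.memLp_of_hasCompactSupport hs)

theorem IsTestFunction.continuous_pderiv {n : ℕ} {U : Set (E n)} {η : E n → ℂ}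
    (h : IsTestFunction U η) (j : Fin n) : Continuous (pderiv j η) :=
  (h.smooth.continuous_fderiv (by simp)).clm_apply continuous_const

theorem IsTestFunction.compact_pderiv {n : ℕ} {U : Set (E n)} {η : E n → ℂ}
    (h : IsTestFunction U η) (j : Fin n) : HasCompactSupport (pderiv j η) :=
  h.compact.fderiv_apply ℝ _

/-- The Sobolev space `H¹(U)`, as the space of pairs `(u, (∂₁u, …, ∂ₙu))` of an `L²` function
and its `L²` weak derivatives, with the (product) topology of `L²` convergence of the function
and of its first derivatives. -/
def H1 {n : ℕ} (U : Set (E n)) : Submodule ℂ (L2 U × (Fin n → L2 U)) where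
  carrier := {w | ∀ j, IsWeakDeriv U j w.1 (w.2 j)}
  zero_mem' := by
    intro j η hη
    have h0 : ((0 : L2 U) : E n → ℂ) =ᵐ[volume.restrict U] 0 := Lp.coeFn_zero _ _ _
    have e1 : ∫ x in U, (0 : L2 U × (Fin n → L2 U)).1 x * pderiv j η x = 0 := by
      refine integral_eq_zero_of_ae ?_
      filter_upwards [h0] with x hx
      have : (0 : L2 U × (Fin n → L2 U)).1 x = 0 := hx
      simp only [this, zero_mul, Pi.zero_apply]
    have e2 : ∫ x in U, (0 : L2 U × (Fin n → L2 U)).2 j x * η x = 0 := by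
      refine integral_eq_zero_of_ae ?_
      filter_upwards [h0] with x hx
      have : (0 : L2 U × (Fin n → L2 U)).2 j x = 0 := hx
      simp only [this, zero_mul, Pi.zero_apply]
    rw [e1, e2, neg_zero]
  add_mem' := by
    intro v w hv hw j η hη
    have e1 : ∫ x in U, (v + w).1 x * pderiv j η x
        = ∫ x in U, (v.1 x * pderiv j η x + w.1 x * pderiv j η x) := by
      refine integral_congr_ae ?_
      filter_upwards [Lp.coeFn_add v.1 w.1] with x hx
      have : (v + w).1 x = v.1 x + w.1 x := hx
      rw [this, add_mul]
    have e2 : ∫ x in U, (v + w).2 j x * η x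
        = ∫ x in U, (v.2 j x * η x + w.2 j x * η x) := by
      refine integral_congr_ae ?_
      filter_upwards [Lp.coeFn_add (v.2 j) (w.2 j)] with x hx
      have : (v + w).2 j x = v.2 j x + w.2 j x := hx
      rw [this, add_mul]
    have hp := hη.continuous_pderiv j
    have hq := hη.compact_pderiv j
    rw [e1, e2, integral_add (integrable_mul_of_compact _ hp hq) (integrable_mul_of_compact _ hp hq),
      integral_add (integrable_mul_of_compact _ hη.smooth.continuous hη.compact)
        (integrable_mul_of_compact _ hη.smooth.continuous hη.compact), hv j η hη, hw j η hη]
    ring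
  smul_mem' := by
    intro r v hv j η hη
    have e1 : ∫ x in U, (r • v).1 x * pderiv j η x = r * ∫ x in U, v.1 x * pderiv j η x := by
      rw [← integral_const_mul]
      refine integral_congr_ae ?_
      filter_upwards [Lp.coeFn_smul r v.1] with x hx
      have : (r • v).1 x = r * v.1 x := hx
      rw [this, mul_assoc]
    have e2 : ∫ x in U, (r • v).2 j x * η x = r * ∫ x in U, v.2 j x * η x := by
      rw [← integral_const_mul]
      refine integral_congr_ae ?_
      filter_upwards [Lp.coeFn_smul r (v.2 j)] with x hx
      have : (r • v).2 j x = r * v.2 j x := hx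
      rw [this, mul_assoc]
    rw [e1, e2, hv j η hη]
    ring

/-- The function underlying an element of `H¹(U)`. -/
def fn {n : ℕ} {U : Set (E n)} (w : H1 U) : L2 U := w.1.1

/-- The weak derivative `∂w/∂x^j`. -/
def grad {n : ℕ} {U : Set (E n)} (w : H1 U) (j : Fin n) : L2 U := w.1.2 j

/-- `H_D(U)` as a space of functions: the closure of `C_0^∞(U)` in `H¹(U)`. Its norm is
`Medium.normHD`; for bounded `U` that norm is equivalent on `C_0^∞(U)` to the `H¹` norm, so that
this is the completion of `C_0^∞(U)` in the Dirichlet norm. -/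
def HD {n : ℕ} (U : Set (E n)) : Submodule ℂ (H1 U) :=
  (Submodule.span ℂ {w : H1 U | ∃ η, IsTestFunction U η ∧ (fn w : E n → ℂ) =ᵐ[volume.restrict U] η ∧
    ∀ j, (grad w j : E n → ℂ) =ᵐ[volume.restrict U] pderiv j η}).topologicalClosure

/-- Restriction of an `L²` function to a subset. -/
def L2.restrict {n : ℕ} {U V : Set (E n)} (h : V ⊆ U) (u : L2 U) : L2 V :=
  ((Lp.memLp u).mono_measure (Measure.restrict_mono_set volume h)).toLp u

theorem L2.coeFn_restrict {n : ℕ} {U V : Set (E n)} (h : V ⊆ U) (u : L2 U) :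
    (L2.restrict h u : E n → ℂ) =ᵐ[volume.restrict V] u :=
  MemLp.coeFn_toLp _

theorem L2.integral_restrict_mul {n : ℕ} {U V : Set (E n)} (h : V ⊆ U) (u : L2 U)
    {η : E n → ℂ} (hη : Function.support η ⊆ V) :
    ∫ x in V, L2.restrict h u x * η x = ∫ x in U, u x * η x := by
  have e : ∫ x in V, L2.restrict h u x * η x = ∫ x in V, u x * η x := by
    refine integral_congr_ae ?_
    filter_upwards [L2.coeFn_restrict h u] with x hx
    rw [hx]
  have hz : ∀ x, x ∉ V → u x * η x = 0 := by
    intro x hx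
    have : η x = 0 := by
      by_contra hne
      exact hx (hη hne)
    rw [this, mul_zero]
  rw [e, setIntegral_eq_integral_of_forall_compl_eq_zero hz,
    setIntegral_eq_integral_of_forall_compl_eq_zero (fun x hx => hz x (fun hV => hx (h hV)))]

/-- Restriction `H¹(U) → H¹(V)` for `V ⊆ U`. -/
def H1.restrict {n : ℕ} {U V : Set (E n)} (h : V ⊆ U) (w : H1 U) : H1 V :=
  ⟨(L2.restrict h (fn w), fun j => L2.restrict h (grad w j)), by
    intro j η hη
    have hs : Function.support (pderiv j η) ⊆ V := by
      intro x hx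
      refine hη.supp (support_fderiv_subset ℝ (f := η) ?_)
      intro h0
      apply hx
      change fderiv ℝ η x _ = 0
      rw [h0]
      rfl
    have h1 := L2.integral_restrict_mul h (fn w) hs
    have h2 := L2.integral_restrict_mul h (grad w j) ((subset_tsupport η).trans hη.supp)
    change ∫ x in V, L2.restrict h (fn w) x * pderiv j η x
      = - ∫ x in V, L2.restrict h (grad w j) x * η x
    rw [h1, h2]
    exact w.2 j η ⟨hη.smooth, hη.compact, hη.supp.trans h⟩⟩

/-- The space `H^{1/2}(∂U)` of boundary values of `H¹(U)` functions: two functions have the same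
boundary values iff their difference lies in the closure of `C_0^∞(U)`. -/
abbrev BoundaryValues {n : ℕ} (U : Set (E n)) : Type := H1 U ⧸ HD U

/-- The boundary trace `w ↦ w|_{∂U}`. -/
def trace {n : ℕ} {U : Set (E n)} (w : H1 U) : BoundaryValues U := Submodule.Quotient.mk w

/-! ### The Dirichlet form and the energy -/

namespace Medium

variable {n : ℕ} (M : Medium n)

/-- The density of `dVol = (det g)^{1/2} dx`. -/
def vol (x : E n) : ℝ := Real.sqrt (M.g x).det

/-- `D_j w = -i ∂w/∂x^j + a_j w`, in terms of the value `z` and the derivatives `ζ` of `w` at `x`. -/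
def D (x : E n) (z : ℂ) (ζ : Fin n → ℂ) (j : Fin n) : ℂ :=
  -Complex.I * ζ j + (M.a x j : ℂ) * z

/-- The pointwise form `g^{ij} (D_i w) conj(D_j η) + c⁻² q w conj(η)`, where `(z, ζ)`, `(z', ζ')`
are the values and derivatives of `w` and `η` at `x`. -/
def density (x : E n) (z : ℂ) (ζ : Fin n → ℂ) (z' : ℂ) (ζ' : Fin n → ℂ) : ℂ :=
  (∑ i, ∑ j, (((M.g x)⁻¹ i j : ℝ) : ℂ) * M.D x z ζ i * conj (M.D x z' ζ' j))
    + (((M.c x ^ 2)⁻¹ * M.q x : ℝ) : ℂ) * z * conj z'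

/-- The weak form of `P` against a test function:
`(Pw, η)_{L²(U; c⁻² dVol)} = ∫_U (g^{ij} D_i w conj(D_j η) + c⁻² q w conj(η)) dVol`. -/
def form {U : Set (E n)} (w : H1 U) (η : E n → ℂ) : ℂ :=
  ∫ x in U, M.density x (fn w x) (fun j => grad w j x) (η x) (fun j => pderiv j η x) * (M.vol x : ℂ)

/-- The pairing `(w, η)_{L²(U; c⁻² dVol)}`. -/
def pairing {U : Set (E n)} (w : L2 U) (η : E n → ℂ) : ℂ :=
  ∫ x in U, (((M.c x ^ 2)⁻¹ * M.vol x : ℝ) : ℂ) * (w x * conj (η x))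

/-- The integral `∫_V (|Dw|² + c⁻² q |w|²) dVol`, for `w ∈ H¹(U)` and `V ⊆ U`. -/
def dirichlet {U : Set (E n)} (V : Set (E n)) (w : H1 U) : ℝ :=
  ∫ x in V, (M.density x (fn w x) (fun j => grad w j x) (fn w x) (fun j => grad w j x)).re * M.vol x

/-- The Dirichlet norm on `H_D(U)`. -/
def normHD {U : Set (E n)} (w : H1 U) : ℝ := Real.sqrt (M.dirichlet U w)

/-- The energy `∫_V (|Dw|² + c⁻² q |w|² + c⁻² |w_t|²) dVol` of a state `(w, w_t)` defined on
`U ⊇ V`. -/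
def energy {U : Set (E n)} (V : Set (E n)) (w : H1 U × L2 U) : ℝ :=
  ∫ x in V, ((M.density x (fn w.1 x) (fun j => grad w.1 j x) (fn w.1 x)
    (fun j => grad w.1 j x)).re + (M.c x ^ 2)⁻¹ * ‖w.2 x‖ ^ 2) * M.vol x

/-! ### Finite energy solutions of the wave equation -/

/-- `t ↦ (u(t), u_t(t))` is a finite energy weak solution of `(∂_t² + P) u = 0` in `(0,T) × U`:
`u ∈ C([0,T]; H¹(U)) ∩ C¹([0,T]; L²(U))` with time derivative the second component, and for every
test function `η`, `d/dt (u_t, η) = -(Pu, η)` on `(0,T)`, with `(Pu, η)` in the weak sense. -/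
structure IsWave (U : Set (E n)) (T : ℝ) (u : ℝ → H1 U × L2 U) : Prop where
  continuousOn : ContinuousOn u (Icc 0 T)
  hasDeriv : ∀ t ∈ Icc 0 T, HasDerivWithinAt (fun s => fn (u s).1) (u t).2 (Icc 0 T) t
  equation : ∀ η, IsTestFunction U η → ∀ t ∈ Ioo 0 T,
    HasDerivAt (fun s => M.pairing (u s).2 η) (-M.form (u t).1 η) t

/-- `u` is a solution in `(0,T) × ℝⁿ` with values in the energy space `H_D(ℝⁿ) ⊕ L²(ℝⁿ)` of the
Cauchy problem `(∂_t² + P) u = 0`, `u|_{t=0} = f` (extended as `0` outside `Ω`),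
`∂_t u|_{t=0} = 0`. -/
structure IsCauchySolution (Ω : Set (E n)) (T : ℝ) (f : H1 Ω)
    (u : ℝ → H1 (univ : Set (E n)) × L2 (univ : Set (E n))) : Prop where
  wave : M.IsWave univ T u
  mem_HD : ∀ t ∈ Icc 0 T, (u t).1 ∈ HD (univ : Set (E n))
  initial : (fn (u 0).1 : E n → ℂ) =ᵐ[volume] Ω.indicator (fn f)
  initial_deriv : (u 0).2 = 0

/-- `φ` solves `Pφ = 0` in `Ω`, `φ|_{∂Ω} = b`. -/
structure IsDirichletSolution (Ω : Set (E n)) (b : BoundaryValues Ω) (φ : H1 Ω) : Prop where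
  equation : ∀ η, IsTestFunction Ω η → M.form φ η = 0
  boundary : trace φ = b

/-- `v` solves `(∂_t² + P) v = 0` in `(0,T) × Ω`, `v|_{[0,T] × ∂Ω} = h`, `v|_{t=T} = φ`,
`∂_t v|_{t=T} = 0`, where `Pφ = 0` in `Ω` and `φ|_{∂Ω} = h(T, ·)`. -/
structure IsTimeReversal (Ω : Set (E n)) (T : ℝ) (h : ℝ → BoundaryValues Ω)
    (v : ℝ → H1 Ω × L2 Ω) : Prop where
  wave : M.IsWave Ω T v
  boundary : ∀ t ∈ Icc 0 T, trace (v t).1 = h t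
  final : M.IsDirichletSolution Ω (h T) (v T).1
  final_deriv : (v T).2 = 0

/-- The measurement operator `Λ f = u|_{[0,T] × ∂Ω}`, where `u` is the solution of the Cauchy
problem with data `(f, 0)`. Only the values at `t ∈ [0,T]` are meaningful. -/
def Lam (Ω : Set (E n)) (T : ℝ) (f : H1 Ω) (t : ℝ) : BoundaryValues Ω :=
  trace (H1.restrict (subset_univ Ω) (Classical.epsilon (M.IsCauchySolution Ω T f) t).1)

/-- The pseudo-inverse `A h = v(0, ·)`, where `v` is the solution of the time reversed problem with
boundary data `h`. -/
def A (Ω : Set (E n)) (T : ℝ) (h : ℝ → BoundaryValues Ω) : H1 Ω :=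
  (Classical.epsilon (M.IsTimeReversal Ω T h) 0).1

end Medium

end Thermoacoustic

end

/-! Why the estimate holds. Let `φ` solve `Pφ = 0` in `Ω` with the boundary values of `u(T)`. The
error `w = u - v` is a wave in `Ω` with zero boundary values and Cauchy data `(u(T) - φ, u_t(T))` at
time `T`. Its energy is conserved, so the squared Dirichlet norm of `w(0) = f - AΛf` is at most the
energy of `w` at time `T`. Since `φ` is orthogonal to `H_D(Ω)` in the Dirichlet form, replacing
`u(T)` by `u(T) - φ` can only lower the Dirichlet integral, so that energy is at most `E_Ω(u,T)`.
Finally `E_Ω(u,0)` is the squared Dirichlet norm of `f`, positive by the Poincaré inequality. This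
is `exists_isTimeReversal` followed by a division.

Existence of waves. With `j : V → H` the inclusion of the form domain in `L²`, the bounded operator
`crossOp j` on `V ⊕ H` is self-adjoint and injective, and plays the role of the inverse of the wave
generator. The unitary group is a strong limit of exponentials of bounded operators
(`exists_unitary_orbit`). On bounded `Ω` the Dirichlet form `a` is coercive on `H_D(Ω)` and serves
as the inner product of `V`. On `ℝⁿ` there is no Poincaré inequality: the inner product is `a + h`,
with `h` the mass form, and the surplus `h` is removed by inserting `G = (1 - k²)^{1/2}`, `k =
crossOp j` (`exists_wave_hilbert_of_norm_le_one`).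

Uniqueness. The velocity is only in `L²` and is not an admissible test function, so the energy
identity is applied to the time integral of the solution (`wave_eq_zero`); this needs `a ≥ 0` only.
-/

noncomputable section

namespace Thermoacoustic

/-! ### Unitary groups with unbounded generators -/

section UnitaryGroup

variable {X : Type*} [NormedAddCommGroup X] [InnerProductSpace ℂ X]

theorem tendsto_of_bounded_of_dense {l : Filter ℕ} {B : ℕ → X →L[ℂ] X} {C : ℝ}
    (hB : ∀ n, ‖B n‖ ≤ C) {s : Set X} (hs : Dense s)
    (h : ∀ x ∈ s, Tendsto (fun n => B n x) l (𝓝 0)) (x : X) : Tendsto (fun n => B n x) l (𝓝 0) := by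
  have hC : 0 ≤ C := (norm_nonneg _).trans (hB 0)
  rw [Metric.tendsto_nhds]
  intro ε hε
  obtain ⟨y, hy, hxy⟩ := hs.exists_dist_lt x (ε := ε / (2 * (C + 1))) (by positivity)
  filter_upwards [Metric.tendsto_nhds.1 (h y hy) (ε / 2) (by positivity)] with n hn
  rw [dist_zero_right] at hn ⊢
  have h1 : ‖B n (x - y)‖ ≤ (C + 1) * (ε / (2 * (C + 1))) := by
    refine ((B n).le_opNorm _).trans ?_
    rw [← dist_eq_norm]
    exact mul_le_mul ((hB n).trans (by linarith)) hxy.le dist_nonneg (by positivity)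
  have h2 : (C + 1) * (ε / (2 * (C + 1))) = ε / 2 := by field_simp
  calc ‖B n x‖ = ‖B n (x - y) + B n y‖ := by rw [← map_add, sub_add_cancel]
    _ ≤ ‖B n (x - y)‖ + ‖B n y‖ := norm_add_le _ _
    _ < ε := by linarith

variable [CompleteSpace X]

/-- The unitary operator `exp(i t S)`. -/
def expGroup (S : X →L[ℂ] X) (t : ℝ) : X →L[ℂ] X := NormedSpace.exp (t • (Complex.I • S))

theorem hasDerivAt_expGroup_apply (S : X →L[ℂ] X) (x : X) (t : ℝ) :
    HasDerivAt (fun s => expGroup S s x) (expGroup S t (Complex.I • S x)) t := by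
  have h := hasDerivAt_exp_smul_const (𝕂 := ℝ) (Complex.I • S) t
  have h2 := (((ContinuousLinearMap.apply ℂ X) x).restrictScalars ℝ).hasFDerivAt.comp_hasDerivAt t h
  simpa [expGroup, Function.comp_def] using h2

theorem norm_expGroup_apply {S : X →L[ℂ] X} (hS : IsSelfAdjoint S) (t : ℝ) (x : X) :
    ‖expGroup S t x‖ = ‖x‖ := by
  have hs : IsSelfAdjoint ((t : ℂ) • S) := by
    rw [IsSelfAdjoint, star_smul, hS.star_eq, Complex.star_def, Complex.conj_ofReal]
  have e : expGroup S t = (selfAdjoint.expUnitary ⟨(t : ℂ) • S, hs⟩ : X →L[ℂ] X) := by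
    rw [selfAdjoint.expUnitary_coe, expGroup, smul_comm]
    rfl
  rw [e]
  exact Unitary.norm_map _ x

theorem expGroup_zero (S : X →L[ℂ] X) : expGroup S 0 = 1 := by
  simp [expGroup]

theorem expGroup_add {S R : X →L[ℂ] X} (h : Commute S R) (t : ℝ) :
    expGroup (S + R) t = expGroup S t * expGroup R t := by
  let _ : NormedAlgebra ℚ (X →L[ℂ] X) := NormedAlgebra.restrictScalars ℚ ℂ _
  rw [expGroup, smul_add, smul_add, NormedSpace.exp_add_of_commute]
  · rfl
  · exact ((h.smul_left _).smul_right _).smul_left _ |>.smul_right _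

theorem continuous_expGroup_apply (S : X →L[ℂ] X) (x : X) :
    Continuous (fun t => expGroup S t x) :=
  continuous_iff_continuousAt.2 fun t => (hasDerivAt_expGroup_apply S x t).continuousAt

theorem commute_expGroup {S R : X →L[ℂ] X} (h : Commute S R) (t : ℝ) :
    Commute (expGroup S t) R := by
  let _ : NormedAlgebra ℚ (X →L[ℂ] X) := NormedAlgebra.restrictScalars ℚ ℂ _
  exact (((h.smul_left _).smul_left _).symm.exp_right).symm

theorem norm_expGroup_apply_sub_le {S : X →L[ℂ] X} (hS : IsSelfAdjoint S) (t : ℝ) (x : X) :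
    ‖expGroup S t x - x‖ ≤ |t| * ‖S x‖ := by
  have h := convex_univ.norm_image_sub_le_of_norm_hasDerivWithin_le (𝕜 := ℝ)
    (f := fun s => expGroup S s x) (f' := fun s => expGroup S s (Complex.I • S x))
    (C := ‖S x‖) (x := 0) (y := t)
    (fun s _ => (hasDerivAt_expGroup_apply S x s).hasDerivWithinAt)
    (fun s _ => by rw [norm_expGroup_apply hS, norm_smul]; simp) (mem_univ _) (mem_univ _)
  simpa [expGroup_zero, mul_comm] using h

/-- For commuting generators `exp(itS) = exp(itR) exp(it(S - R))`; the first factor is isometric,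
and the mean value inequality bounds the second minus the identity. -/
theorem norm_expGroup_sub_le {S R : X →L[ℂ] X} (hS : IsSelfAdjoint S) (hR : IsSelfAdjoint R)
    (h : Commute S R) (t : ℝ) (x : X) :
    ‖expGroup S t x - expGroup R t x‖ ≤ |t| * ‖S x - R x‖ := by
  have e : expGroup S t x = expGroup R t (expGroup (S - R) t x) := by
    rw [← mul_apply_eq_comp, ← expGroup_add ((h.symm.sub_right (Commute.refl R)))]
    congr 2
    abel
  rw [e, ← map_sub, norm_expGroup_apply hR]
  exact norm_expGroup_apply_sub_le (hS.sub hR) t x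

/-- The regularisation `k (k² + ε)⁻¹` of the inverse of a self-adjoint operator. -/
def regInv (k : X →L[ℂ] X) (ε : ℝ) : X →L[ℂ] X := cfc (fun r : ℝ => r / (r ^ 2 + ε)) k

theorem norm_regInv_mul_le {k : X →L[ℂ] X} (hk : IsSelfAdjoint k) {ε : ℝ} (hε : 0 < ε) :
    ‖regInv k ε * k‖ ≤ 1 := by
  have hc : Continuous (fun r : ℝ => r / (r ^ 2 + ε)) :=
    continuous_id.div (by fun_prop) (fun r => by positivity)
  nth_rw 2 [← cfc_id ℝ k]
  rw [regInv, ← cfc_mul _ _ k hc.continuousOn continuousOn_id]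
  refine norm_cfc_le zero_le_one fun r _ => ?_
  simp only [id]
  rw [Real.norm_eq_abs, div_mul_eq_mul_div, ← sq, abs_of_nonneg (by positivity),
    div_le_one (by positivity)]
  linarith

/-- The functional calculus turns the operator into the function `-εr/(r² + ε)`, which is at most
`√ε` in modulus because `√ε |r| ≤ r² + ε`. -/
theorem norm_one_sub_regInv_mul_mul_le {k : X →L[ℂ] X} (hk : IsSelfAdjoint k) {ε : ℝ}
    (hε : 0 < ε) : ‖(regInv k ε * k - 1) * k‖ ≤ Real.sqrt ε := by
  have hc : Continuous (fun r : ℝ => r / (r ^ 2 + ε)) :=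
    continuous_id.div (by fun_prop) (fun r => by positivity)
  have e : (regInv k ε * k - 1) * k = cfc (fun r : ℝ => (r / (r ^ 2 + ε) * r - 1) * r) k := by
    have hc2 : Continuous (fun r : ℝ => r / (r ^ 2 + ε) * r) := hc.mul continuous_id
    rw [cfc_mul (fun r : ℝ => r / (r ^ 2 + ε) * r - 1) (fun r => r) k
        (hc2.sub continuous_const).continuousOn continuousOn_id,
      cfc_sub _ _ k hc2.continuousOn (by fun_prop),
      cfc_mul _ _ k hc.continuousOn (by fun_prop), cfc_id' ℝ k, cfc_const_one ℝ k]
    rfl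
  rw [e]
  refine norm_cfc_le (Real.sqrt_nonneg _) fun r _ => ?_
  have e2 : (r / (r ^ 2 + ε) * r - 1) * r = -(ε * r) / (r ^ 2 + ε) := by
    have : r ^ 2 + ε ≠ 0 := by positivity
    field_simp
    ring
  rw [e2, Real.norm_eq_abs, abs_div, abs_neg, abs_of_pos (show 0 < r ^ 2 + ε by positivity),
    div_le_iff₀ (by positivity), abs_mul, abs_of_pos hε]
  have h1 := Real.sq_sqrt hε.le
  have h2 : 0 < Real.sqrt ε := Real.sqrt_pos.2 hε
  have h3 : r ^ 2 = |r| ^ 2 := (sq_abs r).symm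
  generalize Real.sqrt ε = s at *
  subst h1
  rw [h3]
  have : s ^ 2 * |r| ≤ s * (|r| ^ 2 + s ^ 2) := by
    have : s * (s * |r|) ≤ s * (|r| ^ 2 + s ^ 2) := by
      apply mul_le_mul_of_nonneg_left _ h2.le
      nlinarith [sq_nonneg (s - |r|), sq_nonneg (s + |r|)]
    linarith
  exact this

theorem denseRange_of_isSelfAdjoint {k : X →L[ℂ] X} (hk : IsSelfAdjoint k)
    (hinj : Function.Injective k) : DenseRange k := by
  have h := ContinuousLinearMap.orthogonal_range k
  rw [show ContinuousLinearMap.adjoint k = k from hk] at h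
  rw [LinearMap.ker_eq_bot.2 hinj] at h
  have := (Submodule.topologicalClosure_eq_top_iff).2 h
  exact Submodule.dense_iff_topologicalClosure_eq_top.2 this

/-- Strong convergence to the identity: on the dense range of `k` it holds at rate `√ε`, and the
uniform bound by `1` carries it to every vector. -/
theorem tendsto_regInv_mul {k : X →L[ℂ] X} (hk : IsSelfAdjoint k) (hinj : Function.Injective k)
    (x : X) : Tendsto (fun n : ℕ => regInv k (1 / ((n : ℝ) + 1)) (k x)) atTop (𝓝 x) := by
  have hpos : ∀ n : ℕ, (0 : ℝ) < 1 / ((n : ℝ) + 1) := fun n => by positivity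
  have h := tendsto_of_bounded_of_dense (l := atTop)
    (B := fun n : ℕ => regInv k (1 / ((n : ℝ) + 1)) * k - 1)
    (C := 1 + ‖(1 : X →L[ℂ] X)‖) (fun n => (norm_sub_le _ _).trans
      (by gcongr; exact norm_regInv_mul_le hk (hpos n)))
    (denseRange_of_isSelfAdjoint hk hinj) (by
      rintro _ ⟨y, rfl⟩
      refine squeeze_zero_norm (a := fun n : ℕ => Real.sqrt (1 / ((n : ℝ) + 1)) * ‖y‖) (fun n => ?_) ?_
      · exact (((regInv k (1 / ((n : ℝ) + 1)) * k - 1) * k).le_opNorm y).trans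
          (by gcongr; exact norm_one_sub_regInv_mul_mul_le hk (hpos n))
      · have := (Real.continuous_sqrt.tendsto 0).comp tendsto_one_div_add_atTop_nhds_zero_nat
        simpa using this.mul_const ‖y‖) x
  have h2 := h.add_const x
  simpa using h2

/-- For commuting bounded self-adjoint operators `k`, `G` with `k` injective, the unitary group
with generator `i G k⁻¹` exists. -/
theorem exists_unitary_orbit {k G : X →L[ℂ] X} (hk : IsSelfAdjoint k)
    (hinj : Function.Injective k) (hG : IsSelfAdjoint G) (hc : Commute k G) (z : X) :
    ∃ Z : ℝ → X, Continuous Z ∧ Z 0 = z ∧ (∀ t, ‖Z t‖ = ‖z‖) ∧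
      ∀ t, k (Z t) = k z + Complex.I • G (∫ s in (0 : ℝ)..t, Z s) := by
  set F : ℕ → X →L[ℂ] X := fun n => regInv k (1 / ((n : ℝ) + 1)) with hF
  have hpos : ∀ n : ℕ, (0 : ℝ) < 1 / ((n : ℝ) + 1) := fun n => by positivity
  have hFk : ∀ n, Commute (F n) k := fun n => Commute.cfc_real (Commute.refl k) _
  have hFG : ∀ n, Commute (F n) G := fun n => Commute.cfc_real hc _
  have hFs : ∀ n, IsSelfAdjoint (F n) := fun n => IsSelfAdjoint.cfc
  have hFF : ∀ n m, Commute (F n) (F m) := fun n m =>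
    Commute.cfc_real (Commute.cfc_real (Commute.refl k) _).symm _
  -- Bounded self-adjoint approximations of the unbounded generator `G k⁻¹`. They all commute, so
  -- their exponentials can be compared directly.
  set S : ℕ → X →L[ℂ] X := fun n => G * F n with hS
  have hSs : ∀ n, IsSelfAdjoint (S n) := fun n => by
    rw [hS, IsSelfAdjoint, star_mul, (hFs n).star_eq, hG.star_eq]
    exact hFG n
  have hSk : ∀ n, Commute (S n) k := fun n => hc.symm.mul_left (hFk n)
  have hSS : ∀ n m, Commute (S n) (S m) := fun n m =>
    ((Commute.refl G).mul_left (hFG n)).mul_right ((hFG m).symm.mul_left (hFF n m))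
  have hSkx : ∀ x, Tendsto (fun n => S n (k x)) atTop (𝓝 (G x)) := fun x =>
    (G.continuous.tendsto _).comp (tendsto_regInv_mul hk hinj x)
  -- uniform Cauchy property on bounded intervals
  have hcauchy : ∀ (R : ℝ) (x : X),
      UniformCauchySeqOn (fun n t => expGroup (S n) t x) atTop (Icc (-R) R) := by
    intro R x
    rcases lt_or_ge R 0 with hR | hR
    · rw [Icc_eq_empty (by linarith)]
      intro u _
      exact Eventually.of_forall fun _ _ h => h.elim
    rw [Metric.uniformCauchySeqOn_iff]
    intro ε hε
    -- Vectors `k w` are dense and lie in the domain of the limit generator: `S n (k w)` converges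
    -- to `G w`. The error `x - k w` is carried isometrically by both exponentials.
    obtain ⟨w, hxy⟩ := (denseRange_of_isSelfAdjoint hk hinj).exists_dist_lt x
      (ε := ε / 3) (by positivity)
    obtain ⟨N, hN⟩ := Metric.cauchySeq_iff.1 (hSkx w).cauchySeq (ε / (3 * (R + 1))) (by positivity)
    refine ⟨N, fun m hm n hn t ht => ?_⟩
    have h1 := norm_expGroup_sub_le (hSs m) (hSs n) (hSS m n) t (k w)
    have h2 := hN m hm n hn
    have ht' : |t| ≤ R := abs_le.2 ht
    have h3 : |t| * ‖S m (k w) - S n (k w)‖ ≤ ε / 3 := by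
      rw [dist_eq_norm] at h2
      calc _ ≤ (R + 1) * (ε / (3 * (R + 1))) :=
            mul_le_mul (by linarith) h2.le (norm_nonneg _) (by positivity)
        _ = ε / 3 := by field_simp
    have e : expGroup (S m) t x - expGroup (S n) t x = expGroup (S m) t (x - k w)
        + (expGroup (S m) t (k w) - expGroup (S n) t (k w)) - expGroup (S n) t (x - k w) := by
      rw [map_sub, map_sub]; abel
    rw [dist_eq_norm] at hxy ⊢
    rw [e]
    calc _ ≤ ‖expGroup (S m) t (x - k w)‖ + ‖expGroup (S m) t (k w) - expGroup (S n) t (k w)‖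
          + ‖expGroup (S n) t (x - k w)‖ := (norm_sub_le _ _).trans (by gcongr; exact norm_add_le _ _)
      _ < ε := by rw [norm_expGroup_apply (hSs m), norm_expGroup_apply (hSs n)]; linarith
  have hlim : ∀ t, ∃ y, Tendsto (fun n => expGroup (S n) t z) atTop (𝓝 y) := fun t =>
    cauchySeq_tendsto_of_complete ((hcauchy |t| z).cauchySeq (x := t) (abs_le.1 le_rfl))
  choose Z hZ using hlim
  have hZn : ∀ t, ‖Z t‖ = ‖z‖ := fun t => by
    refine tendsto_nhds_unique (hZ t).norm ?_
    simp only [norm_expGroup_apply (hSs _)]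
    exact tendsto_const_nhds
  have hZc : Continuous Z := by
    rw [continuous_iff_continuousAt]
    intro t
    have hu := (hcauchy (|t| + 1) z).tendstoUniformlyOn_of_tendsto (fun s _ => hZ s)
    have := hu.continuousOn (Frequently.of_forall fun n =>
      (continuous_expGroup_apply (S n) z).continuousOn)
    refine this.continuousAt (Icc_mem_nhds ?_ ?_)
    · linarith [neg_abs_le t]
    · linarith [le_abs_self t]
  refine ⟨Z, hZc, ?_, hZn, fun t => ?_⟩
  · refine tendsto_nhds_unique (hZ 0) ?_
    simp only [expGroup_zero]
    exact tendsto_const_nhds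
  have hSkn : ∀ n, ‖S n * k‖ ≤ ‖G‖ := fun n => by
    rw [hS, mul_assoc]
    refine (norm_mul_le _ _).trans ?_
    exact mul_le_of_le_one_right (norm_nonneg _) (norm_regInv_mul_le hk (hpos n))
  -- Applying `k` replaces `S n`, whose norm may blow up, by `S n * k`, bounded by `‖G‖`; only in
  -- this form does the evolution equation pass to the limit.
  have happ : ∀ n, k (expGroup (S n) t z) - k z
      = ∫ s in (0 : ℝ)..t, Complex.I • (S n * k) (expGroup (S n) s z) := by
    intro n
    rw [intervalIntegral.integral_eq_sub_of_hasDerivAt (f := fun s => k (expGroup (S n) s z))]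
    · simp [expGroup_zero]
    · intro s _
      have h1 := (k.restrictScalars ℝ).hasFDerivAt.comp_hasDerivAt s
        (hasDerivAt_expGroup_apply (S n) z s)
      have h2 : (S n * k) (expGroup (S n) s z) = k (expGroup (S n) s (S n z)) := by
        have h3 : Commute (expGroup (S n) s) (S n) := commute_expGroup (Commute.refl _) s
        rw [hSk n, mul_apply_eq_comp, ← mul_apply_eq_comp (S n), ← h3.eq,
          mul_apply_eq_comp]
      rw [h2, ← map_smul, ← map_smul]
      exact h1
    · exact (((S n * k).continuous.comp (continuous_expGroup_apply (S n) z)).const_smul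
        Complex.I).intervalIntegrable _ _
  have hint : Tendsto (fun n => ∫ s in (0 : ℝ)..t, Complex.I • (S n * k) (expGroup (S n) s z)) atTop
      (𝓝 (∫ s in (0 : ℝ)..t, Complex.I • G (Z s))) := by
    refine intervalIntegral.tendsto_integral_filter_of_dominated_convergence
      (fun _ => ‖G‖ * ‖z‖) ?_ ?_ intervalIntegrable_const ?_
    · exact Eventually.of_forall fun n => (((S n * k).continuous.comp
        (continuous_expGroup_apply (S n) z)).const_smul Complex.I).aestronglyMeasurable
    · refine Eventually.of_forall fun n => ae_of_all _ fun s _ => ?_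
      rw [norm_smul, Complex.norm_I, one_mul]
      refine ((S n * k).le_opNorm _).trans ?_
      rw [norm_expGroup_apply (hSs n)]
      gcongr
      exact hSkn n
    · refine ae_of_all _ fun s _ => Tendsto.const_smul ?_ _
      have h1 : Tendsto (fun n => (S n * k) (expGroup (S n) s z - Z s)) atTop (𝓝 0) := by
        refine squeeze_zero_norm (a := fun n => ‖G‖ * ‖expGroup (S n) s z - Z s‖) (fun n => ?_) ?_
        · exact ((S n * k).le_opNorm _).trans (by gcongr; exact hSkn n)
        · simpa using (tendsto_iff_norm_sub_tendsto_zero.1 (hZ s)).const_mul ‖G‖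
      have h2 := h1.add (hSkx (Z s))
      rw [zero_add] at h2
      refine h2.congr fun n => ?_
      rw [map_sub, mul_apply_eq_comp (S n) k (Z s)]
      abel
  have h1 : Tendsto (fun n => k (expGroup (S n) t z) - k z) atTop (𝓝 (k (Z t) - k z)) :=
    ((k.continuous.tendsto _).comp (hZ t)).sub_const _
  have h2 := tendsto_nhds_unique h1 (by simpa only [happ] using hint)
  rw [intervalIntegral.integral_smul, G.intervalIntegral_comp_comm (hZc.intervalIntegrable _ _)] at h2
  rw [← h2]
  abel

end UnitaryGroup

/-! ### Abstract wave equations -/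

section Hilbert

variable {V H : Type*} [NormedAddCommGroup V] [InnerProductSpace ℂ V] [CompleteSpace V]
  [NormedAddCommGroup H] [InnerProductSpace ℂ H] [CompleteSpace H]

/-- The self-adjoint operator `(u, y) ↦ (-i j* y, i j u)` on `V ⊕ H`. -/
def crossOp (j : V →L[ℂ] H) : WithLp 2 (V × H) →L[ℂ] WithLp 2 (V × H) :=
  ((WithLp.prodContinuousLinearEquiv 2 ℂ V H).symm : V × H →L[ℂ] WithLp 2 (V × H)) ∘L
    (((-Complex.I) • (ContinuousLinearMap.adjoint j ∘L WithLp.sndL 2 ℂ V H)).prod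
      (Complex.I • (j ∘L WithLp.fstL 2 ℂ V H)))

theorem crossOp_fst (j : V →L[ℂ] H) (z : WithLp 2 (V × H)) :
    (crossOp j z).fst = -(Complex.I • ContinuousLinearMap.adjoint j z.snd) := by
  rw [← neg_smul]; rfl

theorem crossOp_snd (j : V →L[ℂ] H) (z : WithLp 2 (V × H)) :
    (crossOp j z).snd = Complex.I • j z.fst := rfl

theorem crossOp_isSelfAdjoint (j : V →L[ℂ] H) : IsSelfAdjoint (crossOp j) := by
  rw [ContinuousLinearMap.isSelfAdjoint_iff_isSymmetric]
  intro x y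
  change inner ℂ (crossOp j x) y = inner ℂ x (crossOp j y)
  rw [WithLp.prod_inner_apply, WithLp.prod_inner_apply]
  change inner ℂ (crossOp j x).fst y.fst + inner ℂ (crossOp j x).snd y.snd
    = inner ℂ x.fst (crossOp j y).fst + inner ℂ x.snd (crossOp j y).snd
  simp only [crossOp_fst, crossOp_snd, inner_neg_left, inner_neg_right, inner_smul_left,
    inner_smul_right, ContinuousLinearMap.adjoint_inner_left,
    ContinuousLinearMap.adjoint_inner_right, Complex.conj_I]
  ring

/-- A vector killed by the adjoint is orthogonal to the range of `j`. -/
theorem adjoint_injective_of_denseRange {j : V →L[ℂ] H} (hd : DenseRange j) :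
    Function.Injective (ContinuousLinearMap.adjoint j) := by
  rw [injective_iff_map_eq_zero]
  intro y hy
  refine Dense.eq_zero_of_inner_left ℂ hd ?_
  rintro _ ⟨x, rfl⟩
  rw [← ContinuousLinearMap.adjoint_inner_left, hy, inner_zero_left]

theorem crossOp_injective {j : V →L[ℂ] H} (hj : Function.Injective j) (hd : DenseRange j) :
    Function.Injective (crossOp j) := by
  rw [injective_iff_map_eq_zero]
  intro z hz
  have h1 : (crossOp j z).fst = 0 := by rw [hz]; rfl
  have h2 : (crossOp j z).snd = 0 := by rw [hz]; rfl
  rw [crossOp_fst, neg_eq_zero, smul_eq_zero_iff_right Complex.I_ne_zero] at h1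
  rw [crossOp_snd, smul_eq_zero_iff_right Complex.I_ne_zero] at h2
  have h3 : z.fst = 0 := (map_eq_zero_iff j hj).1 h2
  have h4 : z.snd = 0 := (map_eq_zero_iff _ (adjoint_injective_of_denseRange hd)).1 h1
  exact (WithLp.ofLp_injective 2) (Prod.ext h3 h4)

/-- The orbits of the group generated by `i G (crossOp j)⁻¹`, in components. -/
theorem exists_wave_orbit {j : V →L[ℂ] H} (hj : Function.Injective j) (hd : DenseRange j)
    {G : WithLp 2 (V × H) →L[ℂ] WithLp 2 (V × H)} (hG : IsSelfAdjoint G)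
    (hc : Commute (crossOp j) G) (z : WithLp 2 (V × H)) :
    ∃ Z : ℝ → WithLp 2 (V × H), Continuous Z ∧ Z 0 = z ∧ (∀ t, ‖Z t‖ = ‖z‖) ∧
      (∀ t, HasDerivAt (fun s => j (Z s).fst) (G (Z t)).snd t) ∧
      ∀ η t, HasDerivAt (fun s => inner ℂ (j η) (G (Z s)).snd)
        (-inner ℂ η (G (G (Z t))).fst) t := by
  obtain ⟨Z, hZc, hZ0, hZn, hZ⟩ := exists_unitary_orbit (crossOp_isSelfAdjoint j)
    (crossOp_injective hj hd) hG hc z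
  have hder : ∀ t, HasDerivAt (fun s => ∫ r in (0 : ℝ)..s, Z r) (Z t) t := fun t =>
    (hZc.integral_hasStrictDerivAt 0 t).hasDerivAt
  refine ⟨Z, hZc, hZ0, hZn, fun t => ?_, fun η t => ?_⟩
  -- The second component of `k Z = k z + i G ∫ Z`, with `k = crossOp j`: the velocity of `j u` is
  -- the second component of `G Z`.
  · have h1 : ∀ s, j (Z s).fst = j z.fst + (G (∫ r in (0 : ℝ)..s, Z r)).snd := by
      intro s
      have h := congrArg WithLp.snd (hZ s)
      rw [WithLp.add_snd, WithLp.smul_snd, crossOp_snd, crossOp_snd, ← smul_add] at h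
      exact smul_right_injective _ Complex.I_ne_zero h
    simp only [h1]
    exact (((WithLp.sndL 2 ℂ V H ∘L G).restrictScalars ℝ).hasFDerivAt.comp_hasDerivAt t
      (hder t)).const_add _
  -- Since that velocity involves `G`, the same identity is multiplied by `G`, which commutes with
  -- `crossOp j`, before its first component is read off.
  · have h1 : ∀ s, ContinuousLinearMap.adjoint j (G (Z s)).snd
        = ContinuousLinearMap.adjoint j (G z).snd - (G (G (∫ r in (0 : ℝ)..s, Z r))).fst := by
      intro s
      have h := congrArg WithLp.fst (congrArg G (hZ s))
      have hcomm : ∀ x, G (crossOp j x) = crossOp j (G x) := fun x =>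
        (congrArg (fun A : WithLp 2 (V × H) →L[ℂ] WithLp 2 (V × H) => A x) hc.eq).symm
      rw [map_add, map_smul, hcomm, hcomm, WithLp.add_fst, WithLp.smul_fst, crossOp_fst,
        crossOp_fst, ← smul_neg, ← smul_neg, ← smul_add] at h
      have h2 := smul_right_injective _ Complex.I_ne_zero h
      rw [← neg_inj, h2]
      abel
    have h2 : ∀ s, inner ℂ (j η) (G (Z s)).snd = inner ℂ (j η) (G z).snd
        - inner ℂ η (G (G (∫ r in (0 : ℝ)..s, Z r))).fst := by
      intro s
      rw [← ContinuousLinearMap.adjoint_inner_right, h1, inner_sub_right,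
        ContinuousLinearMap.adjoint_inner_right]
    simp only [h2]
    exact ((((innerSL ℂ η) ∘L WithLp.fstL 2 ℂ V H ∘L G ∘L G).restrictScalars
      ℝ).hasFDerivAt.comp_hasDerivAt t (hder t)).const_sub _

/-- The case `G = 1`: the orbit itself is (displacement, velocity), and unitarity is conservation of
energy. -/
theorem exists_wave_hilbert {j : V →L[ℂ] H} (hj : Function.Injective j) (hd : DenseRange j)
    (f : V) (g : H) :
    ∃ (u : ℝ → V) (v : ℝ → H), Continuous u ∧ Continuous v ∧ u 0 = f ∧ v 0 = g ∧
      (∀ t, HasDerivAt (fun s => j (u s)) (v t) t) ∧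
      (∀ η t, HasDerivAt (fun s => inner ℂ (j η) (v s)) (-inner ℂ η (u t)) t) ∧
      ∀ t, ‖u t‖ ^ 2 + ‖v t‖ ^ 2 = ‖f‖ ^ 2 + ‖g‖ ^ 2 := by
  obtain ⟨Z, hZc, hZ0, hZn, h1, h2⟩ := exists_wave_orbit hj hd (G := 1) (IsSelfAdjoint.one _)
    (Commute.one_right _) (WithLp.toLp 2 (f, g))
  refine ⟨fun t => (Z t).fst, fun t => (Z t).snd, (WithLp.fstL 2 ℂ V H).continuous.comp hZc,
    (WithLp.sndL 2 ℂ V H).continuous.comp hZc, ?_, ?_, h1, h2, fun t => ?_⟩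
  · exact congrArg WithLp.fst hZ0
  · exact congrArg WithLp.snd hZ0
  · rw [← WithLp.prod_norm_sq_eq_of_L2, hZn, WithLp.prod_norm_sq_eq_of_L2]
    rfl

/-- A self-adjoint contraction has `1 - k² ≥ 0`. Its square root comes from the functional calculus,
hence commutes with everything that commutes with `k²`, not merely with `k`; the reflection below
needs this. -/
theorem exists_sqrt_one_sub_mul_self {k : V →L[ℂ] V} (hks : IsSelfAdjoint k)
    (hkn : ∀ x, ‖k x‖ ≤ ‖x‖) :
    ∃ G : V →L[ℂ] V, IsSelfAdjoint G ∧ G * G = 1 - k * k ∧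
      ∀ R, Commute (k * k) R → Commute G R := by
  have hpos : 0 ≤ 1 - k * k := by
    rw [ContinuousLinearMap.nonneg_iff_isPositive]
    refine ⟨?_, fun x => ?_⟩
    · refine ContinuousLinearMap.isSelfAdjoint_iff_isSymmetric.1 ((IsSelfAdjoint.one _).sub ?_)
      rw [IsSelfAdjoint, star_mul, hks.star_eq]
    · have hsym := ContinuousLinearMap.isSelfAdjoint_iff_isSymmetric.1 hks
      have h3 : inner ℂ ((1 - k * k) x) x = inner ℂ x x - inner ℂ (k x) (k x) := by
        have h4 : inner ℂ (k (k x)) x = inner ℂ (k x) (k x) := hsym (k x) x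
        change inner ℂ (x - k (k x)) x = _
        rw [inner_sub_left, h4]
      rw [ContinuousLinearMap.reApplyInnerSelf_apply, h3, map_sub, inner_self_eq_norm_sq,
        inner_self_eq_norm_sq, sub_nonneg]
      exact pow_le_pow_left₀ (norm_nonneg _) (hkn x) 2
  exact ⟨CFC.sqrt (1 - k * k), IsSelfAdjoint.of_nonneg (CFC.sqrt_nonneg _),
    CFC.sqrt_mul_sqrt_self _ hpos,
    fun R hR => Commute.cfcₙ_nnreal ((Commute.one_left R).sub_left hR) _⟩

/-- The reflection `(u, y) ↦ (u, -y)`. -/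
def reflectSnd : WithLp 2 (V × H) →L[ℂ] WithLp 2 (V × H) :=
  ((WithLp.prodContinuousLinearEquiv 2 ℂ V H).symm : V × H →L[ℂ] WithLp 2 (V × H)) ∘L
    ((WithLp.fstL 2 ℂ V H).prod (-WithLp.sndL 2 ℂ V H))

/-- With `G² = 1 - k²`, the generator `G k⁻¹` has square `k⁻² - 1`, which subtracts the mass term
from the form. The velocity is the second component of `G Z`, so prescribing it would require
solving an equation in `G`; for zero velocity `Z 0 = (f, 0)` suffices. -/
theorem exists_wave_hilbert_of_norm_le_one {j : V →L[ℂ] H} (hj : Function.Injective j)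
    (hd : DenseRange j) (hn : ∀ x, ‖j x‖ ≤ ‖x‖) (f : V) :
    ∃ (u : ℝ → V) (v : ℝ → H), Continuous u ∧ Continuous v ∧ u 0 = f ∧ v 0 = 0 ∧
      (∀ t, HasDerivAt (fun s => j (u s)) (v t) t) ∧
      ∀ η t, HasDerivAt (fun s => inner ℂ (j η) (v s))
        (-(inner ℂ η (u t) - inner ℂ (j η) (j (u t)))) t := by
  set k := crossOp j with hk
  have hkn : ∀ z, ‖k z‖ ≤ ‖z‖ := by
    intro z
    refine abs_le_of_sq_le_sq' ?_ (norm_nonneg _) |>.2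
    rw [WithLp.prod_norm_sq_eq_of_L2, WithLp.prod_norm_sq_eq_of_L2, crossOp_fst, crossOp_snd,
      norm_neg, norm_smul, norm_smul, Complex.norm_I, one_mul, one_mul, add_comm]
    have hadj : ‖ContinuousLinearMap.adjoint j z.snd‖ ≤ ‖z.snd‖ := by
      refine (ContinuousLinearMap.le_opNorm _ _).trans ?_
      rw [LinearIsometryEquiv.norm_map]
      exact mul_le_of_le_one_left (norm_nonneg _)
        (j.opNorm_le_bound zero_le_one fun x => by simpa using hn x)
    gcongr
    exact hn _
  have hks : IsSelfAdjoint k := crossOp_isSelfAdjoint j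
  obtain ⟨G, hGs, hGG, hcomm⟩ := exists_sqrt_one_sub_mul_self hks hkn
  have hkG : Commute k G := (hcomm k ((Commute.refl k).mul_left (Commute.refl k))).symm
  -- `k` swaps the two summands, so `k²` is block diagonal and commutes with `(u, y) ↦ (u, -y)`. So
  -- does `G`, which therefore preserves the vectors fixed by this reflection.
  have hdiag : (G (WithLp.toLp 2 (f, 0))).snd = 0 := by
    have h1 : Commute G (reflectSnd (V := V) (H := H)) := by
      refine hcomm _ ?_
      refine ContinuousLinearMap.ext fun x => WithLp.ofLp_injective 2 (Prod.ext ?_ ?_)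
      · change (k (k (reflectSnd x))).fst = (k (k x)).fst
        simp only [hk, crossOp_fst, crossOp_snd]
        rfl
      · change (k (k (reflectSnd x))).snd = -(k (k x)).snd
        simp only [hk, crossOp_fst, crossOp_snd]
        have : (reflectSnd x : WithLp 2 (V × H)).snd = -x.snd := rfl
        rw [this]
        simp
    have h2 : (reflectSnd (WithLp.toLp 2 (f, 0) : WithLp 2 (V × H))) = WithLp.toLp 2 (f, 0) :=
      WithLp.ofLp_injective 2 (Prod.ext rfl neg_zero)
    have h3 := congrArg (fun A : WithLp 2 (V × H) →L[ℂ] WithLp 2 (V × H) =>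
      (A (WithLp.toLp 2 (f, 0))).snd) h1.eq
    simp only [mul_apply_eq_comp, h2] at h3
    have h4 : (G (WithLp.toLp 2 (f, 0))).snd = -(G (WithLp.toLp 2 (f, 0))).snd := h3
    rw [eq_neg_iff_add_eq_zero, ← two_smul ℂ] at h4
    exact (smul_eq_zero.1 h4).resolve_left two_ne_zero
  obtain ⟨Z, hZc, hZ0, hZn, h1, h2⟩ := exists_wave_orbit hj hd hGs hkG (WithLp.toLp 2 (f, 0))
  refine ⟨fun t => (Z t).fst, fun t => (G (Z t)).snd, (WithLp.fstL 2 ℂ V H).continuous.comp hZc,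
    (WithLp.sndL 2 ℂ V H ∘L G).continuous.comp hZc, ?_, ?_, h1, fun η t => ?_⟩
  · exact congrArg WithLp.fst hZ0
  · simp only [hZ0, hdiag]
  · have h3 : inner ℂ η (G (G (Z t))).fst = inner ℂ η (Z t).fst - inner ℂ (j η) (j (Z t).fst) := by
      have h4 : G (G (Z t)) = Z t - k (k (Z t)) :=
        congrArg (fun A : WithLp 2 (V × H) →L[ℂ] WithLp 2 (V × H) => A (Z t)) hGG
      rw [h4, WithLp.sub_fst, hk, crossOp_fst, crossOp_snd, map_smul, smul_smul, Complex.I_mul_I,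
        neg_smul, one_smul, neg_neg, inner_sub_right, ContinuousLinearMap.adjoint_inner_right]
    rw [← h3]
    exact h2 η t

end Hilbert

/-! ### Hermitian forms as inner products, and well-posedness for abstract wave equations -/

section Forms

universe v w

variable {V : Type v} [NormedAddCommGroup V] [NormedSpace ℂ V]

/-- Real scalars suffice for differentiation in time, and over them a sesquilinear form is bilinear.
-/
theorem isBoundedBilinearMap_form (b : V →L⋆[ℂ] V →L[ℂ] ℂ) :
    IsBoundedBilinearMap ℝ (fun p : V × V => b p.1 p.2) where
  add_left x y z := by simp
  smul_left c x y := by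
    rw [← Complex.coe_smul, map_smulₛₗ]; simp
  add_right x y z := by simp
  smul_right c x y := by
    rw [← Complex.coe_smul, map_smul]; simp
  bound := ⟨‖b‖ + 1, by positivity, fun x y => (b.le_opNorm₂ x y).trans (by gcongr; linarith)⟩

theorem hasDerivAt_form_self (b : V →L⋆[ℂ] V →L[ℂ] ℂ) (hs : ∀ x y, conj (b y x) = b x y)
    {x : ℝ → V} {x' : V} {t : ℝ} (hx : HasDerivAt x x' t) :
    HasDerivAt (fun s => (b (x s) (x s)).re) (2 * (b (x t) x').re) t := by
  have h1 := ((isBoundedBilinearMap_form b).hasFDerivAt (x t, x t)).comp_hasDerivAt t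
    (hx.prodMk hx)
  have h2 := Complex.reCLM.hasFDerivAt.comp_hasDerivAt t h1
  have h3 : (b x' (x t)).re = (b (x t) x').re := by rw [← hs, Complex.conj_re]
  have h4 : Complex.reCLM ((isBoundedBilinearMap_form b).deriv (x t, x t) (x', x'))
      = 2 * (b (x t) x').re := by
    change (b (x t) x' + b x' (x t)).re = _
    rw [Complex.add_re, h3]
    ring
  rw [h4] at h2
  exact h2

variable [CompleteSpace V] {H : Type w} [NormedAddCommGroup H] [NormedSpace ℂ H] [CompleteSpace H]

/-- A copy of a complex vector space, to be endowed with the inner product given by a form. -/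
def FormSpace (V : Type v) : Type v := V

/-- A bounded Hermitian coercive form is an inner product defining the given topology. -/
theorem exists_hilbert_of_coercive (b : V →L⋆[ℂ] V →L[ℂ] ℂ) (hs : ∀ x y, conj (b y x) = b x y)
    {δ : ℝ} (hδ : 0 < δ) (hc : ∀ x, δ * ‖x‖ ^ 2 ≤ (b x x).re) :
    ∃ (X : Type v) (_ : NormedAddCommGroup X) (_ : InnerProductSpace ℂ X) (_ : CompleteSpace X)
      (e : V ≃L[ℂ] X), ∀ x y, inner ℂ (e x) (e y) = b x y := by
  let i1 : AddCommGroup (FormSpace V) := inferInstanceAs (AddCommGroup V)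
  let i2 : Module ℂ (FormSpace V) := inferInstanceAs (Module ℂ V)
  let e0 : V ≃ₗ[ℂ] FormSpace V := LinearEquiv.refl ℂ V
  let core : InnerProductSpace.Core ℂ (FormSpace V) :=
    { inner := fun x y => b (e0.symm x) (e0.symm y)
      conj_inner_symm := fun x y => hs _ _
      re_inner_nonneg := fun x => le_trans (by positivity) (hc (e0.symm x))
      add_left := fun x y z => by
        rw [map_add, map_add]; rfl
      smul_left := fun x y r => by
        change b (e0.symm (r • x)) (e0.symm y) = _
        rw [map_smul, map_smulₛₗ]; rfl
      definite := fun x hx => by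
        have h1 := hc (e0.symm x)
        have h2 : b (e0.symm x) (e0.symm x) = 0 := hx
        rw [h2, Complex.zero_re] at h1
        have h3 : ‖e0.symm x‖ = 0 := by
          by_contra hne
          have : 0 < ‖e0.symm x‖ := lt_of_le_of_ne (norm_nonneg _) (Ne.symm hne)
          have : 0 < δ * ‖e0.symm x‖ ^ 2 := by positivity
          linarith
        exact norm_eq_zero.1 h3 }
  let n1 : NormedAddCommGroup (FormSpace V) := InnerProductSpace.Core.toNormedAddCommGroup (𝕜 := ℂ)
  let n2 : InnerProductSpace ℂ (FormSpace V) := InnerProductSpace.ofCore core.toCore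
  have hin : ∀ x y : FormSpace V, inner ℂ x y = b (e0.symm x) (e0.symm y) := fun x y => rfl
  have hnorm : ∀ x : FormSpace V, ‖x‖ ^ 2 = (b (e0.symm x) (e0.symm x)).re := fun x => by
    rw [← hin, ← inner_self_eq_norm_sq (𝕜 := ℂ)]; rfl
  -- The two constants come from `δ ‖x‖² ≤ b(x, x) ≤ ‖b‖ ‖x‖²`.
  let e : V ≃L[ℂ] FormSpace V := e0.toContinuousLinearEquivOfBounds (Real.sqrt ‖b‖)
    (Real.sqrt δ)⁻¹ (fun x => by
      refine abs_le_of_sq_le_sq' ?_ (by positivity) |>.2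
      rw [hnorm, mul_pow, Real.sq_sqrt (norm_nonneg b)]
      refine (Complex.re_le_norm _).trans ((b.le_opNorm₂ _ _).trans (le_of_eq ?_))
      rw [mul_assoc, ← sq]; rfl) (fun x => by
      refine abs_le_of_sq_le_sq' ?_ (by positivity) |>.2
      rw [mul_pow, inv_pow, Real.sq_sqrt hδ.le, hnorm, inv_mul_eq_div, le_div_iff₀ hδ, mul_comm]
      exact hc _)
  have : CompleteSpace (FormSpace V) :=
    (completeSpace_congr (e := e.toEquiv) e.isUniformEmbedding).1 inferInstance
  exact ⟨FormSpace V, n1, n2, inferInstance, e, fun x y => rfl⟩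

/-- Riesz representation in the inner product given by `b`. -/
theorem exists_representative_of_coercive (b : V →L⋆[ℂ] V →L[ℂ] ℂ)
    (hs : ∀ x y, conj (b y x) = b x y) {δ : ℝ} (hδ : 0 < δ)
    (hc : ∀ x, δ * ‖x‖ ^ 2 ≤ (b x x).re) (L : V →L[ℂ] ℂ) : ∃ x, ∀ y, b x y = L y := by
  obtain ⟨X, _, _, _, e, he⟩ := exists_hilbert_of_coercive b hs hδ hc
  refine ⟨e.symm ((InnerProductSpace.toDual ℂ X).symm (L ∘L (e.symm : X →L[ℂ] V))), fun y => ?_⟩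
  rw [← he, e.apply_symm_apply, InnerProductSpace.toDual_symm_apply]
  simp

/-- Solutions of the abstract wave equation `v = ∂ₜ(ι u)`, `∂ₜ h(·, v) = -a(·, u)` for a coercive
form `a`, with conservation of energy. -/
theorem exists_wave_of_coercive {ι : V →L[ℂ] H} (hι : Function.Injective ι) (hd : DenseRange ι)
    (a : V →L⋆[ℂ] V →L[ℂ] ℂ) (has : ∀ x y, conj (a y x) = a x y) {δ : ℝ} (hδ : 0 < δ)
    (hac : ∀ x, δ * ‖x‖ ^ 2 ≤ (a x x).re)
    (h : H →L⋆[ℂ] H →L[ℂ] ℂ) (hhs : ∀ x y, conj (h y x) = h x y) {δ' : ℝ} (hδ' : 0 < δ')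
    (hhc : ∀ x, δ' * ‖x‖ ^ 2 ≤ (h x x).re) (f : V) (g : H) :
    ∃ (u : ℝ → V) (v : ℝ → H), Continuous u ∧ Continuous v ∧ u 0 = f ∧ v 0 = g ∧
      (∀ t, HasDerivAt (fun s => ι (u s)) (v t) t) ∧
      (∀ η t, HasDerivAt (fun s => h (ι η) (v s)) (-a η (u t)) t) ∧
      ∀ t, (a (u t) (u t)).re + (h (v t) (v t)).re = (a f f).re + (h g g).re := by
  obtain ⟨X, _, _, _, e, he⟩ := exists_hilbert_of_coercive a has hδ hac
  obtain ⟨Y, _, _, _, e', he'⟩ := exists_hilbert_of_coercive h hhs hδ' hhc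
  let j : X →L[ℂ] Y := (e' : H →L[ℂ] Y) ∘L ι ∘L (e.symm : X →L[ℂ] V)
  have hj : Function.Injective j := e'.injective.comp (hι.comp e.symm.injective)
  have hjd : DenseRange j :=
    e'.surjective.denseRange.comp (hd.comp e.symm.surjective.denseRange ι.continuous) e'.continuous
  obtain ⟨u, v, huc, hvc, hu0, hv0, h1, h2, h3⟩ := exists_wave_hilbert hj hjd (e f) (e' g)
  refine ⟨fun t => e.symm (u t), fun t => e'.symm (v t), e.symm.continuous.comp huc,
    e'.symm.continuous.comp hvc, by simp [hu0], by simp [hv0], fun t => ?_, fun η t => ?_,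
    fun t => ?_⟩
  · have := ((e'.symm : Y →L[ℂ] H).restrictScalars ℝ).hasFDerivAt.comp_hasDerivAt t (h1 t)
    simpa [j, Function.comp_def] using this
  · have := h2 (e η) t
    simpa [j, ← he, ← he'] using this
  · have := h3 t
    simp only [← inner_self_eq_norm_sq (𝕜 := ℂ), he, he'] at this
    rw [← he, ← he']
    simpa [he, he'] using this

/-- Solutions of the abstract wave equation with vanishing initial velocity, for a form `a` that
is coercive after adding `h`. -/
theorem exists_wave_of_coercive_add {ι : V →L[ℂ] H} (hι : Function.Injective ι)
    (hd : DenseRange ι)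
    (a b : V →L⋆[ℂ] V →L[ℂ] ℂ) (hbs : ∀ x y, conj (b y x) = b x y) {δ : ℝ} (hδ : 0 < δ)
    (hbc : ∀ x, δ * ‖x‖ ^ 2 ≤ (b x x).re) (hpos : ∀ x, 0 ≤ (a x x).re)
    (h : H →L⋆[ℂ] H →L[ℂ] ℂ) (hhs : ∀ x y, conj (h y x) = h x y) {δ' : ℝ} (hδ' : 0 < δ')
    (hhc : ∀ x, δ' * ‖x‖ ^ 2 ≤ (h x x).re) (hab : ∀ x y, b x y = a x y + h (ι x) (ι y)) (f : V) :
    ∃ (u : ℝ → V) (v : ℝ → H), Continuous u ∧ Continuous v ∧ u 0 = f ∧ v 0 = 0 ∧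
      (∀ t, HasDerivAt (fun s => ι (u s)) (v t) t) ∧
      ∀ η t, HasDerivAt (fun s => h (ι η) (v s)) (-a η (u t)) t := by
  obtain ⟨X, _, _, _, e, he⟩ := exists_hilbert_of_coercive b hbs hδ hbc
  obtain ⟨Y, _, _, _, e', he'⟩ := exists_hilbert_of_coercive h hhs hδ' hhc
  let j : X →L[ℂ] Y := (e' : H →L[ℂ] Y) ∘L ι ∘L (e.symm : X →L[ℂ] V)
  have hj : Function.Injective j := e'.injective.comp (hι.comp e.symm.injective)
  have hjd : DenseRange j :=
    e'.surjective.denseRange.comp (hd.comp e.symm.surjective.denseRange ι.continuous) e'.continuous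
  -- The difference of the squared norms is `b(x, x) - h(ιx, ιx) = a(x, x) ≥ 0`.
  have hjn : ∀ x, ‖j x‖ ≤ ‖x‖ := by
    intro x
    refine abs_le_of_sq_le_sq' ?_ (norm_nonneg _) |>.2
    obtain ⟨x, rfl⟩ := e.surjective x
    rw [← inner_self_eq_norm_sq (𝕜 := ℂ), ← inner_self_eq_norm_sq (𝕜 := ℂ), he, hab]
    have : j (e x) = e' (ι x) := by simp [j]
    rw [this, he', map_add]
    have := hpos x
    simpa using this
  obtain ⟨u, v, huc, hvc, hu0, hv0, h1, h2⟩ :=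
    exists_wave_hilbert_of_norm_le_one hj hjd hjn (e f)
  refine ⟨fun t => e.symm (u t), fun t => e'.symm (v t), e.symm.continuous.comp huc,
    e'.symm.continuous.comp hvc, by simp [hu0], by simp [hv0], fun t => ?_, fun η t => ?_⟩
  · have := ((e'.symm : Y →L[ℂ] H).restrictScalars ℝ).hasFDerivAt.comp_hasDerivAt t (h1 t)
    simpa [j, Function.comp_def] using this
  · have h3 := h2 (e η) t
    have h4 : inner ℂ (e η) (u t) - inner ℂ (j (e η)) (j (u t)) = a η (e.symm (u t)) := by
      obtain ⟨x, hx⟩ := e.surjective (u t)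
      rw [← hx, he, hab]
      simp [j, he']
    rw [h4] at h3
    simpa [j, ← he'] using h3

theorem eq_of_hasDerivAt_zero {Y : Type*} [NormedAddCommGroup Y] [NormedSpace ℝ Y]
    [CompleteSpace Y] {F : ℝ → Y} {T : ℝ} (hF : ContinuousOn F (Icc 0 T))
    (hF' : ∀ t ∈ Ioo 0 T, HasDerivAt F 0 t) {s t : ℝ} (hs : s ∈ Icc 0 T) (ht : t ∈ Icc 0 T) :
    F t = F s := by
  wlog hst : s ≤ t generalizing s t
  · exact (this ht hs (le_of_not_ge hst)).symm
  have h := intervalIntegral.integral_eq_sub_of_hasDerivAt_of_le (f' := fun _ => (0 : Y)) hst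
    (hF.mono (Icc_subset_Icc hs.1 ht.2))
    (fun r hr => hF' r ⟨hs.1.trans_lt hr.1, hr.2.trans_le ht.2⟩) intervalIntegrable_const
  rw [intervalIntegral.integral_zero] at h
  exact (sub_eq_zero.1 h.symm)

/-- Uniqueness for the abstract wave equation. -/
theorem wave_eq_zero {ι : V →L[ℂ] H} (hι : Function.Injective ι)
    (a : V →L⋆[ℂ] V →L[ℂ] ℂ) (has : ∀ x y, conj (a y x) = a x y) (hpos : ∀ x, 0 ≤ (a x x).re)
    (h : H →L⋆[ℂ] H →L[ℂ] ℂ) (hhs : ∀ x y, conj (h y x) = h x y)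
    (hhpos : ∀ x, x ≠ 0 → 0 < (h x x).re) {T t₀ : ℝ} (ht₀ : t₀ ∈ Icc 0 T) {u : ℝ → V} {v : ℝ → H}
    (hu : ContinuousOn u (Icc 0 T)) (hv : ContinuousOn v (Icc 0 T)) (hu0 : u t₀ = 0)
    (hv0 : v t₀ = 0) (h1 : ∀ t ∈ Icc 0 T, HasDerivWithinAt (fun s => ι (u s)) (v t) (Icc 0 T) t)
    {D : Set V} (hD : Dense D)
    (h2 : ∀ η ∈ D, ∀ t ∈ Ioo 0 T, HasDerivAt (fun s => h (ι η) (v s)) (-a η (u t)) t) :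
    ∀ t ∈ Icc 0 T, u t = 0 ∧ v t = 0 := by
  have hT : 0 ≤ T := ht₀.1.trans ht₀.2
  -- Continuous extension to all of `ℝ`, so that the primitives below are differentiable everywhere.
  set u' : ℝ → V := IccExtend hT ((Icc 0 T).domRestrict u) with hu'
  set v' : ℝ → H := IccExtend hT ((Icc 0 T).domRestrict v) with hv'
  have hu'c : Continuous u' := (continuousOn_iff_continuous_domRestrict.1 hu).Icc_extend'
  have hv'c : Continuous v' := (continuousOn_iff_continuous_domRestrict.1 hv).Icc_extend'
  have hu'e : ∀ t ∈ Icc 0 T, u' t = u t := fun t ht => IccExtend_of_mem hT _ ht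
  have hv'e : ∀ t ∈ Icc 0 T, v' t = v t := fun t ht => IccExtend_of_mem hT _ ht
  -- Integration in time gains one derivative: `U` and its derivative `u` both take values in `V`,
  -- so the energy identity for the pair `(U, W)` is legitimate.
  set U : ℝ → V := fun t => ∫ s in t₀..t, u' s with hU
  set W : ℝ → H := fun t => ∫ s in t₀..t, v' s with hW
  have hUd : ∀ t, HasDerivAt U (u' t) t := fun t => (hu'c.integral_hasStrictDerivAt t₀ t).hasDerivAt
  have hWd : ∀ t, HasDerivAt W (v' t) t := fun t => (hv'c.integral_hasStrictDerivAt t₀ t).hasDerivAt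
  have hU0 : U t₀ = 0 := intervalIntegral.integral_same
  have hW0 : W t₀ = 0 := intervalIntegral.integral_same
  have hUc : Continuous U := continuous_iff_continuousAt.2 fun t => (hUd t).continuousAt
  have hWc : Continuous W := continuous_iff_continuousAt.2 fun t => (hWd t).continuousAt
  have hιu : ∀ t ∈ Icc 0 T, ι (u t) = W t := by
    intro t ht
    have := eq_of_hasDerivAt_zero (F := fun s => ι (u s) - W s)
      ((ι.continuous.comp_continuousOn hu).sub hWc.continuousOn) (fun s hs => by
        have h3 := ((h1 s (Ioo_subset_Icc_self hs)).hasDerivAt (Icc_mem_nhds hs.1 hs.2)).sub (hWd s)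
        rwa [hv'e s (Ioo_subset_Icc_self hs), sub_self] at h3) ht₀ ht
    rw [hu0, hW0, map_zero, sub_zero] at this
    exact sub_eq_zero.1 this
  -- The weak equation integrated from `t₀`. Both sides are continuous in `η`, so it passes from the
  -- dense set `D` to all of `V`, in particular to `η = u t`.
  have hhv : ∀ η, ∀ t ∈ Icc 0 T, h (ι η) (v t) = -a η (U t) := by
    intro η t ht
    have hcl : IsClosed {η | h (ι η) (v t) = -a η (U t)} :=
      isClosed_eq (((ContinuousLinearMap.apply ℂ ℂ (v t)).continuous.comp h.continuous).comp
        ι.continuous) ((ContinuousLinearMap.apply ℂ ℂ (U t)).continuous.comp a.continuous).neg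
    refine closure_minimal (fun η hη => ?_) hcl (hD η)
    have := eq_of_hasDerivAt_zero (F := fun s => h (ι η) (v s) + a η (U s))
      (((h (ι η)).continuous.comp_continuousOn hv).add
        ((a η).continuous.comp hUc).continuousOn) (fun s hs => by
        have h3 := (h2 η hη s hs).add
          (((a η).restrictScalars ℝ).hasFDerivAt.comp_hasDerivAt s (hUd s))
        rw [hu'e s (Ioo_subset_Icc_self hs)] at h3
        change HasDerivAt _ (-a η (u s) + a η (u s)) s at h3
        rwa [neg_add_cancel] at h3) ht₀ ht
    rw [hv0, hU0, map_zero, map_zero, add_zero] at this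
    exact eq_neg_of_add_eq_zero_left this
  -- The derivative is `2 Re h(W, v) + 2 Re a(U, u)`. As `W = ι u`, the integrated equation with `η
  -- = u` makes the first term `-2 Re a(u, U)`, and Hermitian symmetry cancels the two.
  have hen : ∀ t ∈ Icc 0 T, (h (W t) (W t)).re + (a (U t) (U t)).re = 0 := by
    intro t ht
    have hder : ∀ s, HasDerivAt (fun s => (h (W s) (W s)).re + (a (U s) (U s)).re)
        (2 * (h (W s) (v' s)).re + 2 * (a (U s) (u' s)).re) s := fun s =>
      (hasDerivAt_form_self h hhs (hWd s)).add (hasDerivAt_form_self a has (hUd s))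
    have := eq_of_hasDerivAt_zero (F := fun s => (h (W s) (W s)).re + (a (U s) (U s)).re)
      (continuous_iff_continuousAt.2 fun s => (hder s).continuousAt).continuousOn (fun s hs => by
        have hs' := Ioo_subset_Icc_self hs
        have h3 := hder s
        rw [hu'e s hs', hv'e s hs', ← hιu s hs', hhv (u s) s hs', ← has (U s) (u s)] at h3
        simpa using h3) ht₀ ht
    rw [this, hU0, hW0]
    simp
  have hWz : ∀ t ∈ Icc 0 T, W t = 0 := by
    intro t ht
    by_contra hne
    have := hhpos _ hne
    have := hpos (U t)
    linarith [hen t ht]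
  -- For `T = 0` the interval is a point, where derivatives within it are not unique.
  rcases hT.eq_or_lt with rfl | hT
  · intro t ht
    have : t = t₀ := (le_antisymm ht.2 ht.1).trans (le_antisymm ht₀.2 ht₀.1).symm
    rw [this]
    exact ⟨hu0, hv0⟩
  · intro t ht
    refine ⟨(map_eq_zero_iff ι hι).1 ((hιu t ht).trans (hWz t ht)), ?_⟩
    have h3 : HasDerivWithinAt W (v t) (Icc 0 T) t := by
      rw [← hv'e t ht]; exact (hWd t).hasDerivWithinAt
    have h4 : HasDerivWithinAt W 0 (Icc 0 T) t :=
      (hasDerivWithinAt_const t _ (0 : H)).congr_of_mem hWz ht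
    exact (uniqueDiffOn_Icc hT t ht).eq_deriv _ h3 h4

end Forms

/-! ### Sobolev spaces -/

section Sobolev

variable {n : ℕ} {U V : Set (E n)}

theorem inner_L2_eq (u v : L2 U) : inner ℂ u v = ∫ x in U, v x * conj (u x) := by
  rw [L2.inner_def]
  rfl

theorem IsTestFunction.conj {η : E n → ℂ} (h : IsTestFunction U η) :
    IsTestFunction U (fun x => conj (η x)) where
  smooth := Complex.conjCLE.contDiff.comp h.smooth
  compact := h.compact.comp_left (g := fun z : ℂ => (starRingEnd ℂ) z) (map_zero _)
  supp := by
    refine subset_trans (closure_mono ?_) h.supp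
    intro x hx h0
    exact hx (by simp only [h0, map_zero])

/-- A continuous compactly supported function as an element of `L²(U)`. -/
def toL2 (U : Set (E n)) {η : E n → ℂ} (hc : Continuous η) (hs : HasCompactSupport η) : L2 U :=
  (hc.memLp_of_hasCompactSupport hs).toLp η

theorem coeFn_toL2 {η : E n → ℂ} (hc : Continuous η) (hs : HasCompactSupport η) :
    (toL2 U hc hs : E n → ℂ) =ᵐ[volume.restrict U] η :=
  MemLp.coeFn_toLp _

theorem inner_toL2 {η : E n → ℂ} (hc : Continuous η) (hs : HasCompactSupport η) (u : L2 U) :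
    inner ℂ (toL2 U hc hs) u = ∫ x in U, u x * conj (η x) := by
  rw [inner_L2_eq]
  refine integral_congr_ae ?_
  filter_upwards [coeFn_toL2 (U := U) hc hs] with x hx
  rw [hx]

theorem continuous_integral_mul {η : E n → ℂ} (hc : Continuous η) (hs : HasCompactSupport η) :
    Continuous (fun u : L2 U => ∫ x in U, u x * η x) := by
  have hc' : Continuous (fun x => conj (η x)) := Complex.continuous_conj.comp hc
  have hs' : HasCompactSupport (fun x => conj (η x)) :=
    hs.comp_left (g := fun z : ℂ => (starRingEnd ℂ) z) (map_zero _)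
  have : (fun u : L2 U => ∫ x in U, u x * η x) = fun u => inner ℂ (toL2 U hc' hs') u := by
    funext u
    rw [inner_toL2]
    simp
  rw [this]
  fun_prop

/-- The only `L²` function orthogonal to the test functions is zero. -/
theorem L2.eq_zero_of_integral (hU : IsOpen U) {u : L2 U}
    (h : ∀ η, IsTestFunction U η → ∫ x in U, u x * η x = 0) : u = 0 := by
  have h1 : ∀ᵐ x ∂(volume.restrict U), x ∈ U → u x = 0 := by
    refine hU.ae_eq_zero_of_integral_contDiff_smul_eq_zero ?_ fun g hg hgc hgs => ?_
    · exact ((Lp.memLp u).locallyIntegrable (by norm_num)).locallyIntegrableOn U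
    · have hη : IsTestFunction U (fun x => (g x : ℂ)) :=
        { smooth := Complex.ofRealCLM.contDiff.comp hg
          compact := hgc.comp_left (g := fun r : ℝ => (r : ℂ)) Complex.ofReal_zero
          supp := by
            refine subset_trans (closure_mono ?_) hgs
            intro x hx h0
            exact hx (by simp only [h0, Complex.ofReal_zero]) }
      rw [← h _ hη]
      refine integral_congr_ae (ae_of_all _ fun x => ?_)
      simp only [Complex.real_smul, mul_comm]
  rw [Lp.eq_zero_iff_ae_eq_zero]
  filter_upwards [h1, ae_restrict_mem hU.measurableSet] with x hx hxU
  exact hx hxU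

theorem isClosed_H1 (U : Set (E n)) : IsClosed (H1 U : Set (L2 U × (Fin n → L2 U))) := by
  have : (H1 U : Set (L2 U × (Fin n → L2 U))) = ⋂ (j : Fin n) (η : E n → ℂ)
      (_ : IsTestFunction U η), {w | ∫ x in U, w.1 x * pderiv j η x = - ∫ x in U, w.2 j x * η x} := by
    ext w
    simp only [mem_iInter]
    rfl
  rw [this]
  refine isClosed_iInter fun j => isClosed_iInter fun η => isClosed_iInter fun hη => ?_
  refine isClosed_eq ?_ ?_
  · exact (continuous_integral_mul (hη.continuous_pderiv j) (hη.compact_pderiv j)).comp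
      continuous_fst
  · exact ((continuous_integral_mul hη.smooth.continuous hη.compact).comp
      ((continuous_apply j).comp continuous_snd)).neg

instance : NormedAddCommGroup (H1 U) := Submodule.normedAddCommGroup (H1 U)

instance : NormedSpace ℂ (H1 U) := Submodule.normedSpace (H1 U)

instance : NormedAddCommGroup (HD U) := Submodule.normedAddCommGroup (HD U)

instance : NormedSpace ℂ (HD U) := Submodule.normedSpace (HD U)

instance : CompleteSpace (H1 U) := (isClosed_H1 U).completeSpace_coe

instance : CompleteSpace (HD U) :=
  (Submodule.isClosed_topologicalClosure _).completeSpace_coe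

/-- The underlying function, as a continuous linear map. -/
def fnL (U : Set (E n)) : H1 U →L[ℂ] L2 U :=
  ContinuousLinearMap.fst ℂ (L2 U) (Fin n → L2 U) ∘L (H1 U).subtypeL

/-- The weak derivatives, as continuous linear maps. -/
def gradL (U : Set (E n)) (j : Fin n) : H1 U →L[ℂ] L2 U :=
  ContinuousLinearMap.proj j ∘L ContinuousLinearMap.snd ℂ (L2 U) (Fin n → L2 U) ∘L (H1 U).subtypeL

theorem H1.ext {w w' : H1 U} (h : fn w = fn w') (h' : ∀ j, grad w j = grad w' j) : w = w' :=
  Subtype.ext (Prod.ext h (funext h'))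

/-- `H1 U` inherits the maximum norm of the product, which is dominated by the Hilbert norm. -/
theorem norm_H1_sq_le (w : H1 U) : ‖w‖ ^ 2 ≤ ‖fn w‖ ^ 2 + ∑ j, ‖grad w j‖ ^ 2 := by
  have h0 : 0 ≤ ∑ j, ‖grad w j‖ ^ 2 := Finset.sum_nonneg fun j _ => by positivity
  refine (Real.le_sqrt (norm_nonneg _) (by positivity)).1 ?_
  refine (norm_prod_le_iff (x := (w : L2 U × (Fin n → L2 U)))).2 ⟨?_, ?_⟩
  · refine Real.le_sqrt_of_sq_le ?_
    change ‖fn w‖ ^ 2 ≤ _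
    linarith
  · refine (pi_norm_le_iff_of_nonneg (Real.sqrt_nonneg _)).2 fun j => Real.le_sqrt_of_sq_le ?_
    change ‖grad w j‖ ^ 2 ≤ _
    have := Finset.single_le_sum (f := fun j => ‖grad w j‖ ^ 2) (fun j _ => by positivity)
      (Finset.mem_univ j)
    have h1 : 0 ≤ ‖fn w‖ ^ 2 := by positivity
    linarith

/-- The function determines its weak derivatives, by the fundamental lemma of the calculus of
variations. -/
theorem fn_injective (hU : IsOpen U) : Function.Injective (fnL U) := by
  rw [injective_iff_map_eq_zero]
  intro w hw
  refine H1.ext hw fun j => ?_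
  refine L2.eq_zero_of_integral hU fun η hη => ?_
  have h1 := w.2 j η hη
  have h2 : ∫ x in U, (w : L2 U × (Fin n → L2 U)).1 x * pderiv j η x = 0 := by
    refine integral_eq_zero_of_ae ?_
    have h0 : (fn w : E n → ℂ) =ᵐ[volume.restrict U] 0 := by
      rw [show fn w = 0 from hw]; exact Lp.coeFn_zero _ _ _
    filter_upwards [h0] with x hx
    have : (w : L2 U × (Fin n → L2 U)).1 x = 0 := hx
    simp only [this, zero_mul, Pi.zero_apply]
  rw [h2] at h1
  exact neg_eq_zero.1 h1.symm

theorem support_pderiv_subset {η : E n → ℂ} (j : Fin n) :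
    Function.support (pderiv j η) ⊆ tsupport η := by
  intro x hx
  refine support_fderiv_subset ℝ (f := η) fun h0 => hx ?_
  change fderiv ℝ η x _ = 0
  rw [h0]
  rfl

/-- A test function as an element of `H¹(U)`. -/
def ofTest {η : E n → ℂ} (hη : IsTestFunction U η) : H1 U :=
  ⟨(toL2 U hη.smooth.continuous hη.compact,
    fun j => toL2 U (hη.continuous_pderiv j) (hη.compact_pderiv j)), by
    intro j ψ hψ
    have e1 : ∫ x in U, toL2 U hη.smooth.continuous hη.compact x * pderiv j ψ x
        = ∫ x, η x * pderiv j ψ x := by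
      rw [← setIntegral_eq_integral_of_forall_compl_eq_zero (s := U) (μ := volume)]
      · refine integral_congr_ae ?_
        filter_upwards [coeFn_toL2 (U := U) hη.smooth.continuous hη.compact] with x hx
        rw [hx]
      · intro x hx
        have : pderiv j ψ x = 0 := by
          by_contra hne
          exact hx (hψ.supp (support_pderiv_subset j hne))
        rw [this, mul_zero]
    have e2 : ∫ x in U, toL2 U (hη.continuous_pderiv j) (hη.compact_pderiv j) x * ψ x
        = ∫ x, pderiv j η x * ψ x := by
      rw [← setIntegral_eq_integral_of_forall_compl_eq_zero (s := U) (μ := volume)]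
      · refine integral_congr_ae ?_
        filter_upwards [coeFn_toL2 (U := U) (hη.continuous_pderiv j) (hη.compact_pderiv j)]
          with x hx
        rw [hx]
      · intro x hx
        have : ψ x = 0 := by
          by_contra hne
          exact hx (hψ.supp (subset_tsupport _ hne))
        rw [this, mul_zero]
    change ∫ x in U, toL2 U hη.smooth.continuous hη.compact x * pderiv j ψ x
      = - ∫ x in U, toL2 U (hη.continuous_pderiv j) (hη.compact_pderiv j) x * ψ x
    rw [e1, e2]
    refine integral_mul_fderiv_eq_neg_fderiv_mul_of_integrable ?_ ?_ ?_ ?_ ?_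
    · exact ((hη.continuous_pderiv j).mul hψ.smooth.continuous).integrable_of_hasCompactSupport
        (hψ.compact.mul_left)
    · exact (hη.smooth.continuous.mul (hψ.continuous_pderiv j)).integrable_of_hasCompactSupport
        (hη.compact.mul_right)
    · exact (hη.smooth.continuous.mul hψ.smooth.continuous).integrable_of_hasCompactSupport
        (hψ.compact.mul_left)
    · exact fun x _ => (hη.smooth.differentiable (by simp)) x
    · exact fun x _ => (hψ.smooth.differentiable (by simp)) x⟩

theorem coeFn_fn_ofTest {η : E n → ℂ} (hη : IsTestFunction U η) :
    (fn (ofTest hη) : E n → ℂ) =ᵐ[volume.restrict U] η :=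
  coeFn_toL2 hη.smooth.continuous hη.compact

theorem coeFn_grad_ofTest {η : E n → ℂ} (hη : IsTestFunction U η) (j : Fin n) :
    (grad (ofTest hη) j : E n → ℂ) =ᵐ[volume.restrict U] pderiv j η :=
  coeFn_toL2 (hη.continuous_pderiv j) (hη.compact_pderiv j)

theorem ofTest_mem_HD {η : E n → ℂ} (hη : IsTestFunction U η) : ofTest hη ∈ HD U :=
  Submodule.le_topologicalClosure _ (Submodule.subset_span
    ⟨η, hη, coeFn_fn_ofTest hη, coeFn_grad_ofTest hη⟩)

/-- A closed subspace containing the test functions contains `H_D(U)`. -/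
theorem HD_le {S : Submodule ℂ (H1 U)} (hS : IsClosed (S : Set (H1 U)))
    (h : ∀ η, ∀ hη : IsTestFunction U η, ofTest hη ∈ S) : HD U ≤ S := by
  refine Submodule.topologicalClosure_minimal _ (Submodule.span_le.2 ?_) hS
  rintro w ⟨η, hη, h1, h2⟩
  have : w = ofTest hη := H1.ext (Lp.ext (h1.trans (coeFn_fn_ofTest hη).symm))
    fun j => Lp.ext ((h2 j).trans (coeFn_grad_ofTest hη j).symm)
  rw [this]
  exact h η hη

/-- The underlying function of an element of `H_D(U)`. -/
def fnHD (U : Set (E n)) : HD U →L[ℂ] L2 U := fnL U ∘L (HD U).subtypeL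

theorem fnHD_injective (hU : IsOpen U) : Function.Injective (fnHD U) :=
  (fn_injective hU).comp Subtype.val_injective

/-- The range contains the test functions, and nothing nonzero in `L²(U)` is orthogonal to them. -/
theorem denseRange_fnHD (hU : IsOpen U) : DenseRange (fnHD U) := by
  have h : (LinearMap.range (fnHD U : HD U →ₗ[ℂ] L2 U))ᗮ = ⊥ := by
    rw [Submodule.eq_bot_iff]
    intro u hu
    refine L2.eq_zero_of_integral hU fun η hη => ?_
    have h1 := (Submodule.mem_orthogonal _ _).1 hu (fnHD U ⟨ofTest hη.conj, ofTest_mem_HD _⟩)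
      ⟨_, rfl⟩
    have h2 : fnHD U ⟨ofTest hη.conj, ofTest_mem_HD _⟩
      = toL2 U hη.conj.smooth.continuous hη.conj.compact := rfl
    rw [h2, inner_toL2] at h1
    simpa using h1
  exact Submodule.dense_iff_topologicalClosure_eq_top.2
    (Submodule.topologicalClosure_eq_top_iff.2 h)

/-! #### Restriction and extension by zero -/

theorem norm_restrict_le (h : V ⊆ U) (u : L2 U) : ‖L2.restrict h u‖ ≤ ‖u‖ := by
  rw [Lp.norm_def, Lp.norm_def]
  refine ENNReal.toReal_mono (Lp.eLpNorm_ne_top u) ?_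
  rw [eLpNorm_congr_ae (L2.coeFn_restrict h u)]
  exact eLpNorm_mono_measure _ (Measure.restrict_mono_set volume h)

theorem ae_restrict_of_subset (h : V ⊆ U) {p : E n → Prop} (hp : ∀ᵐ x ∂volume.restrict U, p x) :
    ∀ᵐ x ∂volume.restrict V, p x :=
  ae_mono (Measure.restrict_mono_set volume h) hp

/-- Restriction `L²(U) → L²(V)` as a continuous linear map. -/
def L2.restrictL (h : V ⊆ U) : L2 U →L[ℂ] L2 V :=
  LinearMap.mkContinuous
    { toFun := L2.restrict h
      map_add' := fun u v => by
        refine Lp.ext ?_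
        filter_upwards [L2.coeFn_restrict h (u + v), L2.coeFn_restrict h u, L2.coeFn_restrict h v,
          Lp.coeFn_add (L2.restrict h u) (L2.restrict h v),
          ae_restrict_of_subset h (Lp.coeFn_add u v)] with x h1 h2 h3 h4 h5
        rw [h1, h4, Pi.add_apply, h2, h3, h5, Pi.add_apply]
      map_smul' := fun r u => by
        refine Lp.ext ?_
        filter_upwards [L2.coeFn_restrict h (r • u), L2.coeFn_restrict h u,
          Lp.coeFn_smul r (L2.restrict h u),
          ae_restrict_of_subset h (Lp.coeFn_smul r u)] with x h1 h2 h4 h5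
        rw [h1, RingHom.id_apply, h4, Pi.smul_apply, h2, h5, Pi.smul_apply] }
    1 (fun u => by simpa using norm_restrict_le h u)

theorem L2.restrictL_apply (h : V ⊆ U) (u : L2 U) : L2.restrictL h u = L2.restrict h u := rfl

/-- Restriction `H¹(U) → H¹(V)` as a continuous linear map. -/
def H1.restrictL (h : V ⊆ U) : H1 U →L[ℂ] H1 V :=
  (((L2.restrictL h ∘L fnL U).prod
    (ContinuousLinearMap.pi fun j => L2.restrictL h ∘L gradL U j)).codRestrict (H1 V)
      fun w => (H1.restrict h w).2)

theorem H1.restrictL_apply (h : V ⊆ U) (w : H1 U) : H1.restrictL h w = H1.restrict h w := rfl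

/-- Extension by zero `L²(V) → L²(ℝⁿ)`. -/
def L2.extend (hV : MeasurableSet V) (u : L2 V) : L2 (univ : Set (E n)) :=
  MemLp.toLp (V.indicator u) (by
    rw [Measure.restrict_univ, memLp_indicator_iff_restrict hV]; exact Lp.memLp u)

theorem L2.coeFn_extend (hV : MeasurableSet V) (u : L2 V) :
    (L2.extend hV u : E n → ℂ) =ᵐ[volume.restrict univ] V.indicator u :=
  MemLp.coeFn_toLp _

theorem ae_univ_iff {p : E n → Prop} : (∀ᵐ x ∂volume.restrict univ, p x) ↔ ∀ᵐ x, p x := by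
  rw [Measure.restrict_univ]

theorem ae_imp_of_ae_restrict_measurable (hV : MeasurableSet V) {p : E n → Prop}
    (hp : ∀ᵐ x ∂volume.restrict V, p x) : ∀ᵐ x ∂volume.restrict univ, x ∈ V → p x :=
  ae_univ_iff.2 ((ae_restrict_iff' hV).1 hp)

/-- Extension by zero `L²(V) → L²(ℝⁿ)` as a continuous linear map. -/
def L2.extendL (hV : MeasurableSet V) : L2 V →L[ℂ] L2 (univ : Set (E n)) :=
  LinearMap.mkContinuous
    { toFun := L2.extend hV
      map_add' := fun u v => by
        refine Lp.ext ?_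
        have h4 := Lp.coeFn_add (L2.extend hV u) (L2.extend hV v)
        filter_upwards [L2.coeFn_extend hV (u + v), L2.coeFn_extend hV u, L2.coeFn_extend hV v,
          h4, ae_imp_of_ae_restrict_measurable hV (Lp.coeFn_add u v)] with x h1 h2 h3 h4 h5
        rw [h1, h4, Pi.add_apply, h2, h3]
        by_cases hx : x ∈ V
        · simp only [indicator_of_mem hx, h5 hx, Pi.add_apply]
        · simp only [indicator_of_notMem hx, add_zero]
      map_smul' := fun r u => by
        refine Lp.ext ?_
        have h4 := Lp.coeFn_smul r (L2.extend hV u)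
        filter_upwards [L2.coeFn_extend hV (r • u), L2.coeFn_extend hV u,
          h4, ae_imp_of_ae_restrict_measurable hV (Lp.coeFn_smul r u)] with x h1 h2 h4 h5
        rw [h1, RingHom.id_apply, h4, Pi.smul_apply, h2]
        by_cases hx : x ∈ V
        · simp only [indicator_of_mem hx, h5 hx, Pi.smul_apply]
        · simp only [indicator_of_notMem hx, smul_zero] }
    1 (fun u => by
      rw [one_mul]
      change ‖L2.extend hV u‖ ≤ ‖u‖
      rw [Lp.norm_def, Lp.norm_def]
      refine ENNReal.toReal_mono (Lp.eLpNorm_ne_top u) ?_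
      rw [eLpNorm_congr_ae (L2.coeFn_extend hV u), Measure.restrict_univ,
        eLpNorm_indicator_eq_eLpNorm_restrict hV])

/-- An element of `H_D(V)` extended by zero is in `H_D(ℝⁿ)`. -/
theorem exists_extension (hV : MeasurableSet V) {w : H1 V} (hw : w ∈ HD V) :
    ∃ w' ∈ HD (univ : Set (E n)), fn w' = L2.extendL hV (fn w) := by
  let Φ : H1 V →L[ℂ] L2 (univ : Set (E n)) × (Fin n → L2 (univ : Set (E n))) :=
    (L2.extendL hV ∘L fnL V).prod (ContinuousLinearMap.pi fun j => L2.extendL hV ∘L gradL V j)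
  let S : Submodule ℂ (L2 (univ : Set (E n)) × (Fin n → L2 (univ : Set (E n)))) :=
    (HD (univ : Set (E n))).map (H1 (univ : Set (E n))).subtype
  have hS : IsClosed (S : Set (L2 (univ : Set (E n)) × (Fin n → L2 (univ : Set (E n))))) :=
    (isClosed_H1 univ).isClosedEmbedding_subtypeVal.isClosedMap _
      (Submodule.isClosed_topologicalClosure _)
  -- The elements whose zero extension, derivatives included, lies in `H_D(ℝⁿ)` form a closed
  -- subspace; it is enough to check test functions, for which the zero extension is the test
  -- function itself.
  have hle : HD V ≤ S.comap (Φ : H1 V →ₗ[ℂ] _) := by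
    refine HD_le (hS.preimage Φ.continuous) fun η hη => ?_
    have hη' : IsTestFunction (univ : Set (E n)) η := ⟨hη.smooth, hη.compact, subset_univ _⟩
    refine ⟨ofTest hη', ofTest_mem_HD hη', ?_⟩
    have key : ∀ (u : L2 V) (u' : L2 (univ : Set (E n))) (ψ : E n → ℂ),
        (u : E n → ℂ) =ᵐ[volume.restrict V] ψ →
        (u' : E n → ℂ) =ᵐ[volume.restrict (univ : Set (E n))] ψ → Function.support ψ ⊆ V →
        u' = L2.extendL hV u := by
      intro u u' ψ h1 h2 h3
      refine Lp.ext ?_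
      filter_upwards [h2, L2.coeFn_extend hV u, ae_imp_of_ae_restrict_measurable hV h1]
        with x h4 h5 h6
      refine h4.trans (Eq.trans ?_ h5.symm)
      by_cases hx : x ∈ V
      · rw [indicator_of_mem hx, h6 hx]
      · rw [indicator_of_notMem hx]
        by_contra hne
        exact hx (h3 hne)
    refine Prod.ext ?_ (funext fun j => ?_)
    · exact key _ _ η (coeFn_fn_ofTest hη) (coeFn_fn_ofTest hη')
        ((subset_tsupport _).trans hη.supp)
    · exact key _ _ (pderiv j η) (coeFn_grad_ofTest hη j) (coeFn_grad_ofTest hη' j)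
        ((support_pderiv_subset j).trans hη.supp)
  obtain ⟨w', hw', he⟩ := hle hw
  exact ⟨w', hw', congrArg Prod.fst he⟩

end Sobolev

/-! ### Bounded coefficients -/

section Coefficients

variable {n : ℕ}

theorem exists_bound_of_eq_outside {m : E n → ℝ} (hc : Continuous m) {K : Set (E n)}
    (hK : IsCompact K) {r : ℝ} (h : ∀ x, x ∉ K → m x = r) : ∃ C, ∀ x, |m x| ≤ C := by
  obtain ⟨C, hC⟩ := hK.exists_bound_of_continuousOn hc.continuousOn
  refine ⟨max C |r|, fun x => ?_⟩
  by_cases hx : x ∈ K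
  · exact (hC x hx).trans (le_max_left _ _)
  · rw [h x hx]
    exact le_max_right _ _

theorem exists_pos_le_of_eq_outside {m : E n → ℝ} (hc : Continuous m) (hpos : ∀ x, 0 < m x)
    {K : Set (E n)} (hK : IsCompact K) {r : ℝ} (hr : 0 < r) (h : ∀ x, x ∉ K → m x = r) :
    ∃ δ, 0 < δ ∧ ∀ x, δ ≤ m x := by
  obtain ⟨δ, hδ, hδm⟩ := hK.exists_forall_le' hc.continuousOn (fun x _ => hpos x)
  refine ⟨min δ r, lt_min hδ hr, fun x => ?_⟩
  by_cases hx : x ∈ K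
  · exact (min_le_left _ _).trans (hδm x hx)
  · rw [h x hx]
    exact min_le_right _ _

namespace Medium

variable (M : Medium n)

theorem det_pos (x : E n) : 0 < (M.g x).det := (M.g_posDef x).det_pos

theorem vol_pos (x : E n) : 0 < M.vol x := Real.sqrt_pos.2 (M.det_pos x)

theorem continuous_g : Continuous M.g :=
  continuous_matrix fun i j => (M.g_smooth i j).continuous

theorem continuous_vol : Continuous M.vol := Real.continuous_sqrt.comp M.continuous_g.matrix_det

theorem continuous_g_inv (i j : Fin n) : Continuous (fun x => (M.g x)⁻¹ i j) := by
  have : (fun x => (M.g x)⁻¹ i j) = fun x => (M.g x).det⁻¹ * (M.g x).adjugate i j := by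
    funext x
    rw [Matrix.inv_def, Matrix.smul_apply, Ring.inverse_eq_inv', smul_eq_mul]
  rw [this]
  exact (M.continuous_g.matrix_det.inv₀ fun x => (M.det_pos x).ne').mul
    (M.continuous_g.matrix_adjugate.matrix_elem i j)

theorem g_inv_symm (x : E n) (i j : Fin n) : (M.g x)⁻¹ i j = (M.g x)⁻¹ j i := by
  have := (M.g_posDef x).inv.1.apply i j
  simpa using this.symm

theorem continuous_c_sq_inv : Continuous (fun x => (M.c x ^ 2)⁻¹) :=
  (M.c_smooth.continuous.pow 2).inv₀ fun x => (pow_pos (M.c_pos x) 2).ne'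

theorem c_sq_inv_pos (x : E n) : 0 < (M.c x ^ 2)⁻¹ := inv_pos.2 (pow_pos (M.c_pos x) 2)

/-- A bounded real coefficient as a complex multiplier. -/
def toBCF (m : E n → ℝ) (hc : Continuous m) (h : ∃ C, ∀ x, |m x| ≤ C) :
    BoundedContinuousFunction (E n) ℂ :=
  BoundedContinuousFunction.ofNormedAddCommGroup (fun x => (m x : ℂ))
    (Complex.continuous_ofReal.comp hc) h.choose
    (fun x => by simpa using h.choose_spec x)

/-- The multiplier `g^{ij} (det g)^{1/2}`. -/
def metricMul (i j : Fin n) : BoundedContinuousFunction (E n) ℂ :=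
  toBCF (fun x => (M.g x)⁻¹ i j * M.vol x) ((M.continuous_g_inv i j).mul M.continuous_vol) (by
    obtain ⟨K, hK, h⟩ := M.trivial_outside
    refine exists_bound_of_eq_outside ((M.continuous_g_inv i j).mul M.continuous_vol) hK
      (r := (1 : Matrix (Fin n) (Fin n) ℝ)⁻¹ i j * 1) fun x hx => ?_
    simp [vol, (h x hx).1])

/-- The multiplier `c⁻² q (det g)^{1/2}`. -/
def potentialMul : BoundedContinuousFunction (E n) ℂ :=
  toBCF (fun x => (M.c x ^ 2)⁻¹ * M.q x * M.vol x)
    ((M.continuous_c_sq_inv.mul M.q_smooth.continuous).mul M.continuous_vol) (by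
    obtain ⟨K, hK, h⟩ := M.trivial_outside
    refine exists_bound_of_eq_outside
      ((M.continuous_c_sq_inv.mul M.q_smooth.continuous).mul M.continuous_vol) hK
      (r := 0) fun x hx => ?_
    simp [(h x hx).2.2.2])

/-- The multiplier `c⁻² (det g)^{1/2}`. -/
def massMul : BoundedContinuousFunction (E n) ℂ :=
  toBCF (fun x => (M.c x ^ 2)⁻¹ * M.vol x) (M.continuous_c_sq_inv.mul M.continuous_vol) (by
    obtain ⟨K, hK, h⟩ := M.trivial_outside
    refine exists_bound_of_eq_outside (M.continuous_c_sq_inv.mul M.continuous_vol) hK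
      (r := 1) fun x hx => ?_
    simp [vol, (h x hx).2.2.1, (h x hx).1])

/-- The multiplier `a_j`. -/
def magneticMul (j : Fin n) : BoundedContinuousFunction (E n) ℂ :=
  toBCF (fun x => M.a x j) (M.a_smooth j).continuous (by
    obtain ⟨K, hK, h⟩ := M.trivial_outside
    refine exists_bound_of_eq_outside (M.a_smooth j).continuous hK (r := 0) fun x hx => ?_
    simp [(h x hx).2.1])

theorem exists_vol_lower : ∃ δ, 0 < δ ∧ ∀ x, δ ≤ M.vol x := by
  obtain ⟨K, hK, h⟩ := M.trivial_outside
  refine exists_pos_le_of_eq_outside M.continuous_vol M.vol_pos hK one_pos fun x hx => ?_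
  simp [vol, (h x hx).1]

theorem exists_mass_lower : ∃ δ, 0 < δ ∧ ∀ x, δ ≤ (M.c x ^ 2)⁻¹ * M.vol x := by
  obtain ⟨K, hK, h⟩ := M.trivial_outside
  refine exists_pos_le_of_eq_outside (M.continuous_c_sq_inv.mul M.continuous_vol)
    (fun x => mul_pos (M.c_sq_inv_pos x) (M.vol_pos x)) hK one_pos fun x hx => ?_
  simp [vol, (h x hx).1, (h x hx).2.2.1]

/-- On the compact set, minimise over `K` times the unit sphere and scale; outside it the metric is
Euclidean and the constant is `1`. -/
theorem exists_ellipticity_real : ∃ δ, 0 < δ ∧ ∀ x, ∀ α : Fin n → ℝ,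
    δ * ∑ i, α i ^ 2 ≤ ∑ i, ∑ j, (M.g x)⁻¹ i j * (α i * α j) := by
  obtain ⟨K, hK, h⟩ := M.trivial_outside
  set Q : E n × E n → ℝ := fun p => ∑ i, ∑ j, (M.g p.1)⁻¹ i j * (p.2 i * p.2 j) with hQ
  have hQc : Continuous Q := by
    refine continuous_finsetSum _ fun i _ => continuous_finsetSum _ fun j _ => ?_
    exact ((M.continuous_g_inv i j).comp continuous_fst).mul (by fun_prop)
  have hQpos : ∀ x (y : E n), y ≠ 0 → 0 < Q (x, y) := by
    intro x y hy
    have h1 := (M.g_posDef x).inv.dotProduct_mulVec_pos (x := fun i => y i) (by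
      intro h0
      exact hy (PiLp.ext fun i => congrFun h0 i))
    refine lt_of_lt_of_eq h1 ?_
    simp only [hQ, dotProduct, Matrix.mulVec, Finset.mul_sum]
    refine Finset.sum_congr rfl fun i _ => Finset.sum_congr rfl fun j _ => ?_
    simp only [Pi.star_apply, star_trivial]
    ring
  obtain ⟨δ, hδ, hmin⟩ := (hK.prod (isCompact_sphere (0 : E n) 1)).exists_forall_le'
    hQc.continuousOn (a := 0) (fun p hp => hQpos p.1 p.2 (by
      intro h0
      have := hp.2
      rw [h0] at this
      simp at this))
  refine ⟨min δ 1, lt_min hδ one_pos, fun x α => ?_⟩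
  have hnn : 0 ≤ ∑ i, α i ^ 2 := Finset.sum_nonneg fun i _ => sq_nonneg _
  by_cases hx : x ∈ K
  · set y : E n := WithLp.toLp 2 α with hy
    have hyn : ‖y‖ ^ 2 = ∑ i, α i ^ 2 := by
      rw [EuclideanSpace.norm_sq_eq]
      simp [hy]
    have hyQ : ∑ i, ∑ j, (M.g x)⁻¹ i j * (α i * α j) = Q (x, y) := rfl
    rw [hyQ, ← hyn]
    by_cases h0 : y = 0
    · rw [h0]
      simp [hQ]
    · have hyp : 0 < ‖y‖ := norm_pos_iff.2 h0
      have h1 := hmin (x, ‖y‖⁻¹ • y) ⟨hx, by simp [norm_smul, hyp.ne']⟩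
      have h2 : Q (x, ‖y‖⁻¹ • y) = (‖y‖ ^ 2)⁻¹ * Q (x, y) := by
        simp only [hQ, Finset.mul_sum, PiLp.smul_apply, smul_eq_mul]
        refine Finset.sum_congr rfl fun i _ => Finset.sum_congr rfl fun j _ => ?_
        rw [← inv_pow]
        ring
      rw [h2, inv_mul_eq_div, le_div_iff₀ (by positivity)] at h1
      exact (mul_le_mul_of_nonneg_right (min_le_left _ _) (by positivity)).trans h1
  · have : ∑ i, ∑ j, (M.g x)⁻¹ i j * (α i * α j) = ∑ i, α i ^ 2 := by
      rw [(h x hx).1]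
      refine Finset.sum_congr rfl fun i _ => ?_
      rw [Finset.sum_eq_single i]
      · simp [sq]
      · intro j _ hj
        simp [Matrix.one_apply_ne hj.symm]
      · simp
    rw [this]
    exact mul_le_of_le_one_left hnn (min_le_right _ _)

/-- The matrix being real, the real part splits into the real quadratic forms of `Re ξ` and `Im ξ`.
-/
theorem exists_ellipticity : ∃ δ, 0 < δ ∧ ∀ x, ∀ ξ : Fin n → ℂ,
    δ * ∑ i, ‖ξ i‖ ^ 2 ≤ (∑ i, ∑ j, (((M.g x)⁻¹ i j : ℝ) : ℂ) * ξ i * conj (ξ j)).re := by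
  obtain ⟨δ, hδ, h⟩ := M.exists_ellipticity_real
  refine ⟨δ, hδ, fun x ξ => ?_⟩
  have h1 := h x fun i => (ξ i).re
  have h2 := h x fun i => (ξ i).im
  have h3 : ∑ i, ‖ξ i‖ ^ 2 = ∑ i, (ξ i).re ^ 2 + ∑ i, (ξ i).im ^ 2 := by
    rw [← Finset.sum_add_distrib]
    refine Finset.sum_congr rfl fun i _ => ?_
    rw [Complex.sq_norm, Complex.normSq_apply]
    ring
  have h4 : (∑ i, ∑ j, (((M.g x)⁻¹ i j : ℝ) : ℂ) * ξ i * conj (ξ j)).re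
      = ∑ i, ∑ j, (M.g x)⁻¹ i j * ((ξ i).re * (ξ j).re)
        + ∑ i, ∑ j, (M.g x)⁻¹ i j * ((ξ i).im * (ξ j).im) := by
    simp only [Complex.re_sum, ← Finset.sum_add_distrib]
    refine Finset.sum_congr rfl fun i _ => Finset.sum_congr rfl fun j _ => ?_
    simp
    ring
  rw [h3, h4, mul_add]
  exact add_le_add h1 h2

end Medium

end Coefficients

/-! ### The Dirichlet form and the mass form -/

section Form

variable {n : ℕ} {U : Set (E n)}

/-- Multiplication by a bounded continuous function on `L²(U)`. -/
def mulL2 (U : Set (E n)) (m : BoundedContinuousFunction (E n) ℂ) : L2 U →L[ℂ] L2 U :=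
  (ContinuousLinearMap.mul ℂ ℂ).holderL (volume.restrict U) ∞ 2 2
    ((memLp_top_of_bound m.continuous.aestronglyMeasurable ‖m‖
      (ae_of_all _ fun x => m.norm_coe_le_norm x)).toLp m)

theorem coeFn_mulL2 (m : BoundedContinuousFunction (E n) ℂ) (u : L2 U) :
    (mulL2 U m u : E n → ℂ) =ᵐ[volume.restrict U] fun x => m x * u x := by
  have h1 := (ContinuousLinearMap.mul ℂ ℂ).coeFn_holder (r := 2)
    ((memLp_top_of_bound (μ := volume.restrict U) m.continuous.aestronglyMeasurable ‖m‖
      (ae_of_all _ fun x => m.norm_coe_le_norm x)).toLp m) u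
  have h2 := MemLp.coeFn_toLp (memLp_top_of_bound (μ := volume.restrict U)
    m.continuous.aestronglyMeasurable ‖m‖ (ae_of_all _ fun x => m.norm_coe_le_norm x))
  filter_upwards [h1, h2] with x hx1 hx2
  refine hx1.trans ?_
  rw [hx2]
  rfl

/-- The sesquilinear form `(x, y) ↦ ⟪B x, A y⟫`. -/
def sesq {X F : Type*} [NormedAddCommGroup X] [NormedSpace ℂ X] [NormedAddCommGroup F]
    [InnerProductSpace ℂ F] (A B : X →L[ℂ] F) : X →L⋆[ℂ] X →L[ℂ] ℂ :=
  (ContinuousLinearMap.precomp ℂ A) ∘SL ((innerSL ℂ : F →L⋆[ℂ] F →L[ℂ] ℂ) ∘SL B)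

namespace Medium

variable (M : Medium n)

/-- The operator `D_j` on `H¹(U)`. -/
def DL (U : Set (E n)) (j : Fin n) : H1 U →L[ℂ] L2 U :=
  (-Complex.I) • gradL U j + mulL2 U (M.magneticMul j) ∘L fnL U

theorem coeFn_DL (w : H1 U) (j : Fin n) : (M.DL U j w : E n → ℂ) =ᵐ[volume.restrict U]
    fun x => M.D x (fn w x) (fun j => grad w j x) j := by
  filter_upwards [Lp.coeFn_add ((-Complex.I) • gradL U j w) (mulL2 U (M.magneticMul j) (fnL U w)),
    Lp.coeFn_smul (-Complex.I) (gradL U j w), coeFn_mulL2 (M.magneticMul j) (fnL U w)]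
    with x h1 h2 h3
  refine h1.trans ?_
  rw [Pi.add_apply, h2, h3]
  rfl

/-- The Dirichlet form on `H¹(U)`, conjugate linear in the first variable. -/
def aForm (U : Set (E n)) : H1 U →L⋆[ℂ] H1 U →L[ℂ] ℂ :=
  (∑ i, ∑ j, sesq (mulL2 U (M.metricMul i j) ∘L M.DL U i) (M.DL U j))
    + sesq (mulL2 U M.potentialMul ∘L fnL U) (fnL U)

/-- The mass form on `L²(U)`, conjugate linear in the first variable. -/
def hForm (U : Set (E n)) : L2 U →L⋆[ℂ] L2 U →L[ℂ] ℂ :=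
  sesq (mulL2 U M.massMul) (ContinuousLinearMap.id ℂ (L2 U))

theorem inner_mulL2 (m : BoundedContinuousFunction (E n) ℂ) (u v : L2 U) {u' v' : E n → ℂ}
    (hu : (u : E n → ℂ) =ᵐ[volume.restrict U] u') (hv : (v : E n → ℂ) =ᵐ[volume.restrict U] v') :
    Integrable (fun x => m x * v' x * conj (u' x)) (volume.restrict U) ∧
      inner ℂ u (mulL2 U m v) = ∫ x in U, m x * v' x * conj (u' x) := by
  have h : (fun x => inner ℂ (u x) (mulL2 U m v x)) =ᵐ[volume.restrict U]
      fun x => m x * v' x * conj (u' x) := by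
    filter_upwards [coeFn_mulL2 m v, hu, hv] with x h1 h2 h3
    rw [h1, h2, h3]
    rfl
  exact ⟨(L2.integrable_inner u (mulL2 U m v)).congr h, by
    rw [L2.inner_def]; exact integral_congr_ae h⟩

/-- The bridge between the operator form and the pointwise density. Integrability is recorded too,
since later splittings and comparisons of integrals depend on it. -/
theorem aForm_eq_integral (η w : H1 U) :
    Integrable (fun x => M.density x (fn w x) (fun j => grad w j x) (fn η x)
      (fun j => grad η j x) * (M.vol x : ℂ)) (volume.restrict U) ∧
    M.aForm U η w = ∫ x in U, M.density x (fn w x) (fun j => grad w j x) (fn η x)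
      (fun j => grad η j x) * (M.vol x : ℂ) := by
  have h1 := fun i j => inner_mulL2 (M.metricMul i j) (M.DL U j η) (M.DL U i w)
    (M.coeFn_DL η j) (M.coeFn_DL w i)
  have h2 := inner_mulL2 M.potentialMul (fn η) (fn w) EventuallyEq.rfl EventuallyEq.rfl
  have e : (fun x => M.density x (fn w x) (fun j => grad w j x) (fn η x)
      (fun j => grad η j x) * (M.vol x : ℂ))
      = fun x => (∑ i, ∑ j, M.metricMul i j x * M.D x (fn w x) (fun j => grad w j x) i *
        conj (M.D x (fn η x) (fun j => grad η j x) j))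
        + M.potentialMul x * fn w x * conj (fn η x : ℂ) := by
    funext x
    rw [density, add_mul, Finset.sum_mul]
    congr 1
    · refine Finset.sum_congr rfl fun i _ => ?_
      rw [Finset.sum_mul]
      refine Finset.sum_congr rfl fun j _ => ?_
      have : M.metricMul i j x = (((M.g x)⁻¹ i j * M.vol x : ℝ) : ℂ) := rfl
      rw [this]
      push_cast
      ring
    · have : M.potentialMul x = (((M.c x ^ 2)⁻¹ * M.q x * M.vol x : ℝ) : ℂ) := rfl
      rw [this]
      push_cast
      ring
  have hint : Integrable (fun x => ∑ i, ∑ j, M.metricMul i j x *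
      M.D x (fn w x) (fun j => grad w j x) i * conj (M.D x (fn η x) (fun j => grad η j x) j))
      (volume.restrict U) :=
    integrable_finsetSum _ fun i _ => integrable_finsetSum _ fun j _ => (h1 i j).1
  rw [e]
  refine ⟨hint.add h2.1, ?_⟩
  rw [integral_add hint h2.1, ← h2.2, integral_finsetSum _ fun i _ =>
    integrable_finsetSum _ fun j _ => (h1 i j).1]
  simp only [aForm, add_apply, sum_apply]
  congr 1
  refine Finset.sum_congr rfl fun i _ => ?_
  rw [integral_finsetSum _ fun j _ => (h1 i j).1]
  exact Finset.sum_congr rfl fun j _ => (h1 i j).2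

theorem hForm_eq_integral (η v : L2 U) :
    Integrable (fun x => (((M.c x ^ 2)⁻¹ * M.vol x : ℝ) : ℂ) * (v x * conj (η x)))
      (volume.restrict U) ∧
    M.hForm U η v = ∫ x in U, (((M.c x ^ 2)⁻¹ * M.vol x : ℝ) : ℂ) * (v x * conj (η x)) := by
  have h := inner_mulL2 M.massMul η v EventuallyEq.rfl EventuallyEq.rfl
  simp only [mul_assoc] at h
  exact h

end Medium

end Form

/-! ### Symmetry, positivity and a Gårding inequality -/

section FormProperties

variable {n : ℕ} {U : Set (E n)}

theorem integrable_norm_sq (u : L2 U) : Integrable (fun x => ‖u x‖ ^ 2) (volume.restrict U) :=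
  (memLp_two_iff_integrable_sq_norm (Lp.aestronglyMeasurable u)).1 (Lp.memLp u)

theorem norm_sq_eq_integral (u : L2 U) : ‖u‖ ^ 2 = ∫ x in U, ‖u x‖ ^ 2 := by
  have h : ((‖u‖ ^ 2 : ℝ) : ℂ) = ∫ x in U, ((‖u x‖ ^ 2 : ℝ) : ℂ) := by
    have h1 : inner ℂ u u = ((‖u‖ ^ 2 : ℝ) : ℂ) := by
      rw [inner_self_eq_norm_sq_to_K]; simp
    rw [← h1, inner_L2_eq]
    refine integral_congr_ae (ae_of_all _ fun x => ?_)
    simp only [Complex.mul_conj, Complex.normSq_eq_norm_sq]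
  rw [integral_complex_ofReal] at h
  exact_mod_cast h

namespace Medium

variable (M : Medium n)

theorem conj_density (x : E n) (z z' : ℂ) (ζ ζ' : Fin n → ℂ) :
    conj (M.density x z ζ z' ζ') = M.density x z' ζ' z ζ := by
  simp only [density, map_add, map_sum, map_mul, Complex.conj_ofReal, Complex.conj_conj]
  congr 1
  · rw [Finset.sum_comm]
    refine Finset.sum_congr rfl fun i _ => Finset.sum_congr rfl fun j _ => ?_
    rw [M.g_inv_symm x j i]
    ring
  · ring

theorem conj_aForm (η w : H1 U) : conj (M.aForm U w η) = M.aForm U η w := by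
  rw [(M.aForm_eq_integral w η).2, (M.aForm_eq_integral η w).2, ← integral_conj]
  refine integral_congr_ae (ae_of_all _ fun x => ?_)
  simp only [map_mul, Complex.conj_ofReal, conj_density]

theorem conj_hForm (η w : L2 U) : conj (M.hForm U w η) = M.hForm U η w := by
  rw [(M.hForm_eq_integral w η).2, (M.hForm_eq_integral η w).2, ← integral_conj]
  refine integral_congr_ae (ae_of_all _ fun x => ?_)
  simp only [map_mul, Complex.conj_ofReal, Complex.conj_conj, mul_comm]

theorem density_self_lower {δ : ℝ} (hδ : ∀ x, ∀ ξ : Fin n → ℂ,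
    δ * ∑ i, ‖ξ i‖ ^ 2 ≤ (∑ i, ∑ j, (((M.g x)⁻¹ i j : ℝ) : ℂ) * ξ i * conj (ξ j)).re)
    (x : E n) (z : ℂ) (ζ : Fin n → ℂ) :
    δ * ∑ j, ‖M.D x z ζ j‖ ^ 2 ≤ (M.density x z ζ z ζ).re := by
  rw [density, Complex.add_re]
  have h1 : 0 ≤ ((((M.c x ^ 2)⁻¹ * M.q x : ℝ) : ℂ) * z * conj z).re := by
    rw [mul_assoc, Complex.mul_conj, ← Complex.ofReal_mul, Complex.ofReal_re]
    exact mul_nonneg (mul_nonneg (M.c_sq_inv_pos x).le (M.q_nonneg x)) (Complex.normSq_nonneg z)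
  linarith [hδ x (M.D x z ζ)]

theorem re_aForm_self (w : H1 U) : (M.aForm U w w).re = M.dirichlet U w ∧
    Integrable (fun x => (M.density x (fn w x) (fun j => grad w j x) (fn w x)
      (fun j => grad w j x)).re * M.vol x) (volume.restrict U) := by
  obtain ⟨h1, h2⟩ := M.aForm_eq_integral w w
  have e : ∀ x, (M.density x (fn w x) (fun j => grad w j x) (fn w x)
      (fun j => grad w j x) * (M.vol x : ℂ)).re = (M.density x (fn w x) (fun j => grad w j x) (fn w x)
      (fun j => grad w j x)).re * M.vol x := fun x => Complex.re_mul_ofReal _ _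
  have h3 := h1.re
  have h4 := integral_re h1
  simp only [RCLike.re_eq_complex_re, e] at h3 h4
  exact ⟨by rw [h2]; exact h4.symm, h3⟩

/-- The constant is the ellipticity constant times the lower bound of the volume density, hence
independent of `U`. -/
theorem exists_aForm_lower : ∃ δ, 0 < δ ∧ ∀ (U : Set (E n)) (w : H1 U),
    δ * ∑ j, ‖M.DL U j w‖ ^ 2 ≤ (M.aForm U w w).re := by
  obtain ⟨δ, hδ, h⟩ := M.exists_ellipticity
  obtain ⟨δ', hδ', h'⟩ := M.exists_vol_lower
  refine ⟨δ * δ', mul_pos hδ hδ', fun U w => ?_⟩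
  have hi : ∀ j ∈ Finset.univ, Integrable (fun x => ‖M.DL U j w x‖ ^ 2) (volume.restrict U) :=
    fun j _ => integrable_norm_sq _
  have e : δ * δ' * ∑ j, ‖M.DL U j w‖ ^ 2
      = ∫ x in U, δ * δ' * ∑ j, ‖M.DL U j w x‖ ^ 2 := by
    simp only [norm_sq_eq_integral]
    rw [← integral_finsetSum _ hi, integral_const_mul]
  rw [e, (M.re_aForm_self w).1]
  refine integral_mono_ae ((integrable_finsetSum _ hi).const_mul _) (M.re_aForm_self w).2 ?_
  filter_upwards [ae_all_iff.2 fun j => M.coeFn_DL w j] with x hx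
  simp only [hx]
  have h1 := M.density_self_lower h x (fn w x) (fun j => grad w j x)
  have h2 : 0 ≤ ∑ j, ‖M.D x (fn w x) (fun j => grad w j x) j‖ ^ 2 :=
    Finset.sum_nonneg fun j _ => by positivity
  calc _ = δ * (∑ j, ‖M.D x (fn w x) (fun j => grad w j x) j‖ ^ 2) * δ' := by ring
    _ ≤ _ := mul_le_mul h1 (h' x) hδ'.le (le_trans (by positivity) h1)

theorem re_aForm_nonneg (w : H1 U) : 0 ≤ (M.aForm U w w).re := by
  obtain ⟨δ, hδ, h⟩ := M.exists_aForm_lower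
  exact le_trans (mul_nonneg hδ.le (Finset.sum_nonneg fun j _ => by positivity)) (h U w)

theorem re_hForm_self (v : L2 U) :
    (M.hForm U v v).re = ∫ x in U, (M.c x ^ 2)⁻¹ * ‖v x‖ ^ 2 * M.vol x ∧
    Integrable (fun x => (M.c x ^ 2)⁻¹ * ‖v x‖ ^ 2 * M.vol x) (volume.restrict U) := by
  obtain ⟨h1, h2⟩ := M.hForm_eq_integral v v
  have e : ∀ x, ((((M.c x ^ 2)⁻¹ * M.vol x : ℝ) : ℂ) * (v x * conj (v x))).re
      = (M.c x ^ 2)⁻¹ * ‖v x‖ ^ 2 * M.vol x := fun x => by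
    rw [Complex.mul_conj, ← Complex.ofReal_mul, Complex.ofReal_re, Complex.normSq_eq_norm_sq]
    ring
  have h3 := h1.re
  have h4 := integral_re h1
  simp only [RCLike.re_eq_complex_re, e] at h3 h4
  exact ⟨by rw [h2]; exact h4.symm, h3⟩

theorem exists_hForm_lower : ∃ δ, 0 < δ ∧ ∀ (U : Set (E n)) (v : L2 U),
    δ * ‖v‖ ^ 2 ≤ (M.hForm U v v).re := by
  obtain ⟨δ, hδ, h⟩ := M.exists_mass_lower
  refine ⟨δ, hδ, fun U v => ?_⟩
  rw [(M.re_hForm_self v).1, norm_sq_eq_integral, ← integral_const_mul]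
  refine integral_mono ((integrable_norm_sq v).const_mul _) (M.re_hForm_self v).2 fun x => ?_
  have := mul_le_mul_of_nonneg_right (h x) (sq_nonneg ‖v x‖)
  simp only
  linarith

theorem energy_eq (w : H1 U × L2 U) :
    M.energy U w = (M.aForm U w.1 w.1).re + (M.hForm U w.2 w.2).re := by
  obtain ⟨h1, h2⟩ := M.re_aForm_self w.1
  obtain ⟨h3, h4⟩ := M.re_hForm_self w.2
  rw [h1, h3, dirichlet, ← integral_add h2 h4, energy]
  simp only [add_mul]

theorem norm_grad_sq_le (w : H1 U) (j : Fin n) :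
    ‖grad w j‖ ^ 2 ≤ 2 * ‖M.DL U j w‖ ^ 2 + 2 * (‖mulL2 U (M.magneticMul j)‖ * ‖fn w‖) ^ 2 := by
  have e : grad w j = Complex.I • (M.DL U j w - mulL2 U (M.magneticMul j) (fn w)) := by
    have : M.DL U j w = (-Complex.I) • grad w j + mulL2 U (M.magneticMul j) (fn w) := rfl
    rw [this, add_sub_cancel_right, smul_smul]
    simp
  have h1 : ‖grad w j‖ ≤ ‖M.DL U j w‖ + ‖mulL2 U (M.magneticMul j)‖ * ‖fn w‖ := by
    rw [e, norm_smul, Complex.norm_I, one_mul]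
    exact (norm_sub_le _ _).trans (by gcongr; exact ContinuousLinearMap.le_opNorm _ _)
  nlinarith [norm_nonneg (grad w j), sq_nonneg (‖M.DL U j w‖ - ‖mulL2 U (M.magneticMul j)‖ * ‖fn w‖)]

/-- A Gårding inequality, from `∂_j w = i (D_j w - a_j w)` with bounded `a_j`. It needs no boundary
condition; the `L²` term is later absorbed by the Poincaré inequality when `U` is bounded, or by the
mass form in general. -/
theorem exists_norm_H1_sq_le (U : Set (E n)) : ∃ C, 0 < C ∧ ∀ w : H1 U,
    ‖w‖ ^ 2 ≤ C * ((M.aForm U w w).re + ‖fn w‖ ^ 2) := by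
  obtain ⟨δ, hδ, h⟩ := M.exists_aForm_lower
  set A := ∑ j, 2 * ‖mulL2 U (M.magneticMul j)‖ ^ 2 with hA
  have hA0 : 0 ≤ A := Finset.sum_nonneg fun j _ => by positivity
  refine ⟨2 * δ⁻¹ + (1 + A), by positivity, fun w => ?_⟩
  have h1 : ∑ j, ‖grad w j‖ ^ 2 ≤ 2 * ∑ j, ‖M.DL U j w‖ ^ 2 + A * ‖fn w‖ ^ 2 := by
    rw [hA, Finset.mul_sum, Finset.sum_mul, ← Finset.sum_add_distrib]
    refine Finset.sum_le_sum fun j _ => (M.norm_grad_sq_le w j).trans (le_of_eq ?_)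
    ring
  have h2 : ∑ j, ‖M.DL U j w‖ ^ 2 ≤ δ⁻¹ * (M.aForm U w w).re := by
    rw [inv_mul_eq_div, le_div_iff₀ hδ, mul_comm]
    exact h U w
  have h3 := norm_H1_sq_le w
  have h4 := M.re_aForm_nonneg w
  have h5 : 0 ≤ δ⁻¹ * ‖fn w‖ ^ 2 := by positivity
  have h6 : 0 ≤ (1 + A) * (M.aForm U w w).re := by positivity
  nlinarith

theorem form_eq (w : H1 U) {η : E n → ℂ} (hη : IsTestFunction U η) :
    M.form w η = M.aForm U (ofTest hη) w := by
  rw [(M.aForm_eq_integral _ w).2, form]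
  refine integral_congr_ae ?_
  filter_upwards [coeFn_fn_ofTest hη, ae_all_iff.2 fun j => coeFn_grad_ofTest hη j] with x h1 h2
  simp only [h1, h2]

theorem pairing_eq (v : L2 U) {η : E n → ℂ} (hη : IsTestFunction U η) :
    M.pairing v η = M.hForm U (fn (ofTest hη)) v := by
  rw [(M.hForm_eq_integral _ v).2, pairing]
  refine integral_congr_ae ?_
  filter_upwards [coeFn_fn_ofTest hη] with x h1
  simp only [h1]

end Medium

/-! ### The Poincaré inequality -/

/-- Test functions already form a subspace, so the span in the definition is superfluous. This is
needed for properties, such as quadratic inequalities, that do not define a subspace. -/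
theorem HD_subset_closure : (HD U : Set (H1 U)) ⊆
    closure {w | ∃ η, ∃ hη : IsTestFunction U η, w = ofTest hη} := by
  have hpd : ∀ {η η' : E n → ℂ} (_ : IsTestFunction U η) (_ : IsTestFunction U η') (j : Fin n),
      pderiv j (fun x => η x + η' x) = fun x => pderiv j η x + pderiv j η' x := by
    intro η η' hη hη' j
    funext x
    simp only [pderiv]
    rw [fderiv_fun_add (hη.smooth.differentiable (by simp) x)
      (hη'.smooth.differentiable (by simp) x)]
    rfl
  rw [HD, Submodule.topologicalClosure_coe]
  refine closure_mono fun w hw => ?_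
  refine Submodule.span_induction (p := fun w _ => ∃ η, ∃ hη : IsTestFunction U η, w = ofTest hη)
    ?_ ?_ ?_ ?_ hw
  · rintro w ⟨η, hη, h1, h2⟩
    exact ⟨η, hη, H1.ext (Lp.ext (h1.trans (coeFn_fn_ofTest hη).symm))
      fun j => Lp.ext ((h2 j).trans (coeFn_grad_ofTest hη j).symm)⟩
  · have h0 : IsTestFunction U (fun _ : E n => (0 : ℂ)) :=
      ⟨contDiff_const, HasCompactSupport.zero, by simp [tsupport]⟩
    refine ⟨_, h0, H1.ext (Lp.ext ?_) fun j => Lp.ext ?_⟩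
    · exact (Lp.coeFn_zero _ _ _).trans (coeFn_fn_ofTest h0).symm
    · refine (Lp.coeFn_zero _ _ _).trans (EventuallyEq.trans ?_ (coeFn_grad_ofTest h0 j).symm)
      refine ae_of_all _ fun x => ?_
      simp [pderiv]
  · rintro _ _ _ _ ⟨η, hη, rfl⟩ ⟨η', hη', rfl⟩
    have h : IsTestFunction U (fun x => η x + η' x) :=
      ⟨hη.smooth.add hη'.smooth, hη.compact.add hη'.compact,
        (tsupport_add η η').trans (union_subset hη.supp hη'.supp)⟩
    refine ⟨_, h, H1.ext (Lp.ext ?_) fun j => Lp.ext ?_⟩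
    · filter_upwards [coeFn_fn_ofTest h, coeFn_fn_ofTest hη, coeFn_fn_ofTest hη',
        Lp.coeFn_add (fn (ofTest hη)) (fn (ofTest hη'))] with x h1 h2 h3 h4
      exact h4.trans (by rw [Pi.add_apply, h1, h2, h3])
    · filter_upwards [coeFn_grad_ofTest h j, coeFn_grad_ofTest hη j, coeFn_grad_ofTest hη' j,
        Lp.coeFn_add (grad (ofTest hη) j) (grad (ofTest hη') j)] with x h1 h2 h3 h4
      exact h4.trans (by rw [Pi.add_apply, h1, h2, h3, hpd hη hη'])
  · rintro r _ _ ⟨η, hη, rfl⟩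
    have h : IsTestFunction U (fun x => r * η x) :=
      ⟨contDiff_const.mul hη.smooth, hη.compact.mul_left,
        (tsupport_mul_subset_right).trans hη.supp⟩
    refine ⟨_, h, H1.ext (Lp.ext ?_) fun j => Lp.ext ?_⟩
    · filter_upwards [coeFn_fn_ofTest h, coeFn_fn_ofTest hη,
        Lp.coeFn_smul r (fn (ofTest hη))] with x h1 h2 h4
      exact h4.trans (by rw [Pi.smul_apply, h1, h2, smul_eq_mul])
    · filter_upwards [coeFn_grad_ofTest h j, coeFn_grad_ofTest hη j,
        Lp.coeFn_smul r (grad (ofTest hη) j)] with x h1 h2 h4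
      refine h4.trans ?_
      rw [Pi.smul_apply, h1, h2, smul_eq_mul]
      simp only [pderiv]
      rw [fderiv_const_mul (hη.smooth.differentiable (by simp) x)]
      rfl

/-- The Poincaré inequality for test functions, with a magnetic derivative. -/
theorem integral_norm_sq_le (M : Medium n) {R : ℝ} (hR : ∀ x ∈ U, ‖x‖ ≤ R) (i : Fin n)
    {η : E n → ℂ} (hη : IsTestFunction U η) :
    ∫ x, ‖η x‖ ^ 2 ≤ 4 * R ^ 2 * ∫ x, ‖M.D x (η x) (fun j => pderiv j η x) i‖ ^ 2 := by
  set Dη : E n → ℂ := fun x => M.D x (η x) (fun j => pderiv j η x) i with hDη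
  have hDc : Continuous Dη :=
    (continuous_const.mul (hη.continuous_pderiv i)).add
      ((Complex.continuous_ofReal.comp (M.a_smooth i).continuous).mul hη.smooth.continuous)
  have hDs : HasCompactSupport Dη :=
    ((hη.compact_pderiv i).mul_left).add (hη.compact.mul_left)
  have hηc : Continuous (fun x => ‖η x‖ ^ 2) := hη.smooth.continuous.norm.pow 2
  have hηs : HasCompactSupport (fun x => ‖η x‖ ^ 2) :=
    hη.compact.comp_left (g := fun z : ℂ => ‖z‖ ^ 2) (by simp)
  have hηi : Integrable (fun x => ‖η x‖ ^ 2) := hηc.integrable_of_hasCompactSupport hηs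
  have hDn : HasCompactSupport (fun x => ‖Dη x‖ ^ 2) :=
    hDs.comp_left (g := fun z : ℂ => ‖z‖ ^ 2) (by simp)
  have hDi : Integrable (fun x => ‖Dη x‖ ^ 2) :=
    (hDc.norm.pow 2).integrable_of_hasCompactSupport hDn
  have hder : ∀ x, HasFDerivAt (fun x => ‖η x‖ ^ 2)
      (2 • (innerSL ℝ (η x)).comp (fderiv ℝ η x)) x := fun x =>
    (hη.smooth.differentiable (by simp) x).hasFDerivAt.norm_sq
  have hder' : ∀ x, fderiv ℝ (fun x => ‖η x‖ ^ 2) x (EuclideanSpace.single i 1)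
      = 2 * (conj (η x) * pderiv i η x).re := fun x => by
    rw [(hder x).fderiv]
    simp [pderiv]
    ring
  let p : E n →L[ℝ] ℝ := EuclideanSpace.proj i
  have hp : ∀ x, fderiv ℝ (fun x : E n => p x) x (EuclideanSpace.single i 1) = 1 := fun x => by
    rw [p.hasFDerivAt.fderiv]
    simp [p]
  have hgc : Continuous (fun x => 2 * (conj (η x) * pderiv i η x).re) :=
    continuous_const.mul (Complex.continuous_re.comp
      ((Complex.continuous_conj.comp hη.smooth.continuous).mul (hη.continuous_pderiv i)))
  have hgs : HasCompactSupport (fun x => 2 * (conj (η x) * pderiv i η x).re) := by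
    refine hη.compact.mono fun x hx h0 => hx ?_
    simp only [h0, map_zero, zero_mul, Complex.zero_re, mul_zero]
  -- Since `∂_i x_i = 1`, integration by parts gives `∫ |η|² = -∫ x_i ∂_i |η|²`.
  have hibp := integral_mul_fderiv_eq_neg_fderiv_mul_of_integrable (μ := volume)
    (f := fun x : E n => p x) (g := fun x => ‖η x‖ ^ 2) (v := EuclideanSpace.single i 1)
    (by simpa only [hp, one_mul] using hηi)
    (by
      simp only [hder']
      exact (p.continuous.mul hgc).integrable_of_hasCompactSupport hgs.mul_left)
    ((p.continuous.mul hηc).integrable_of_hasCompactSupport hηs.mul_left)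
    (fun x _ => p.differentiableAt) (fun x _ => (hder x).differentiableAt)
  simp only [hp, one_mul, hder'] at hibp
  have hpt : ∀ x, -(p x * (2 * (conj (η x) * pderiv i η x).re))
      ≤ 1 / 2 * ‖η x‖ ^ 2 + 2 * R ^ 2 * ‖Dη x‖ ^ 2 := by
    intro x
    by_cases hx : x ∈ U
    -- The diamagnetic step: `a_i` is real, so it contributes nothing to the real part of `conj η ·
    -- i D_i η`.
    · have h1 : (conj (η x) * pderiv i η x).re = (conj (η x) * (Complex.I * Dη x)).re := by
        simp only [hDη, Medium.D]
        simp
        ring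
      have h2 : |(conj (η x) * pderiv i η x).re| ≤ ‖η x‖ * ‖Dη x‖ := by
        rw [h1]
        refine (Complex.abs_re_le_norm _).trans (le_of_eq ?_)
        rw [norm_mul, norm_mul, Complex.norm_I, one_mul, Complex.norm_conj]
      have h3 : |p x| ≤ R := (PiLp.norm_apply_le x i).trans (hR x hx)
      have h4 : |p x * (conj (η x) * pderiv i η x).re| ≤ R * (‖η x‖ * ‖Dη x‖) := by
        rw [abs_mul]
        exact mul_le_mul h3 h2 (abs_nonneg _) ((abs_nonneg _).trans h3)
      have h5 := (abs_le.1 h4).1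
      -- `2R|η||Dη| ≤ |η|²/2 + 2R²|Dη|²`; absorbing the half on the left produces the constant
      -- `4R²`.
      nlinarith [sq_nonneg (‖η x‖ - 2 * R * ‖Dη x‖)]
    · have h0 : η x = 0 := by
        by_contra hne
        exact hx (hη.supp (subset_tsupport _ hne))
      rw [h0]
      simp only [map_zero, zero_mul, Complex.zero_re, mul_zero, neg_zero]
      positivity
  have h6 : ∫ x, -(p x * (2 * (conj (η x) * pderiv i η x).re))
      ≤ ∫ x, (1 / 2 * ‖η x‖ ^ 2 + 2 * R ^ 2 * ‖Dη x‖ ^ 2) :=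
    integral_mono ((p.continuous.mul hgc).integrable_of_hasCompactSupport hgs.mul_left).neg
      ((hηi.const_mul _).add (hDi.const_mul _)) hpt
  rw [integral_neg, hibp, neg_neg, integral_add (hηi.const_mul _) (hDi.const_mul _),
    integral_const_mul, integral_const_mul] at h6
  linarith

namespace Medium

variable (M : Medium n)

theorem norm_fn_sq_le_of_mem_HD {R : ℝ} (hR : ∀ x ∈ U, ‖x‖ ≤ R) (i : Fin n)
    {w : H1 U} (hw : w ∈ HD U) : ‖fn w‖ ^ 2 ≤ 4 * R ^ 2 * ‖M.DL U i w‖ ^ 2 := by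
  have hcl : IsClosed {w : H1 U | ‖fnL U w‖ ^ 2 ≤ 4 * R ^ 2 * ‖M.DL U i w‖ ^ 2} :=
    isClosed_le (by fun_prop) (by fun_prop)
  refine closure_minimal ?_ hcl (HD_subset_closure hw)
  rintro _ ⟨η, hη, rfl⟩
  change ‖fn (ofTest hη)‖ ^ 2 ≤ 4 * R ^ 2 * ‖M.DL U i (ofTest hη)‖ ^ 2
  have h0 : ∀ x, x ∉ U → η x = 0 := fun x hx => by
    by_contra hne
    exact hx (hη.supp (subset_tsupport _ hne))
  have h0' : ∀ j x, x ∉ U → pderiv j η x = 0 := fun j x hx => by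
    by_contra hne
    exact hx (hη.supp (support_pderiv_subset j hne))
  have e1 : ‖fn (ofTest hη)‖ ^ 2 = ∫ x, ‖η x‖ ^ 2 := by
    rw [norm_sq_eq_integral, ← setIntegral_eq_integral_of_forall_compl_eq_zero (s := U)
      (μ := volume) (f := fun x => ‖η x‖ ^ 2) (fun x hx => by simp [h0 x hx])]
    refine integral_congr_ae ?_
    filter_upwards [coeFn_fn_ofTest hη] with x h1
    rw [h1]
  have e2 : ‖M.DL U i (ofTest hη)‖ ^ 2
      = ∫ x, ‖M.D x (η x) (fun j => pderiv j η x) i‖ ^ 2 := by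
    rw [norm_sq_eq_integral, ← setIntegral_eq_integral_of_forall_compl_eq_zero (s := U)
      (μ := volume) (f := fun x => ‖M.D x (η x) (fun j => pderiv j η x) i‖ ^ 2)
      (fun x hx => by simp [D, h0 x hx, h0' _ x hx])]
    refine integral_congr_ae ?_
    filter_upwards [M.coeFn_DL (ofTest hη) i, coeFn_fn_ofTest hη,
      ae_all_iff.2 fun j => coeFn_grad_ofTest hη j] with x h1 h2 h3
    simp only [h1, h2, h3]
  rw [e1, e2]
  exact integral_norm_sq_le M hR i hη

/-- The Dirichlet form is coercive on `H_D(U)` for bounded `U`. -/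
theorem exists_aForm_coercive (hn : 0 < n) (hb : Bornology.IsBounded U) :
    ∃ δ, 0 < δ ∧ ∀ w ∈ HD U, δ * ‖w‖ ^ 2 ≤ (M.aForm U w w).re := by
  obtain ⟨R, hR⟩ := hb.exists_norm_le
  obtain ⟨C, hC, h⟩ := M.exists_norm_H1_sq_le U
  obtain ⟨δ, hδ, h'⟩ := M.exists_aForm_lower
  refine ⟨(C * (1 + 4 * R ^ 2 * δ⁻¹))⁻¹, by positivity, fun w hw => ?_⟩
  have h1 := M.norm_fn_sq_le_of_mem_HD hR ⟨0, hn⟩ hw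
  have h2 : ‖M.DL U ⟨0, hn⟩ w‖ ^ 2 ≤ δ⁻¹ * (M.aForm U w w).re := by
    rw [inv_mul_eq_div, le_div_iff₀ hδ, mul_comm]
    refine le_trans ?_ (h' U w)
    gcongr
    exact Finset.single_le_sum (f := fun j => ‖M.DL U j w‖ ^ 2) (fun j _ => by positivity)
      (Finset.mem_univ _)
  rw [inv_mul_eq_div, div_le_iff₀ (by positivity)]
  refine (h w).trans ?_
  have h3 : ‖fn w‖ ^ 2 ≤ 4 * R ^ 2 * (δ⁻¹ * (M.aForm U w w).re) := h1.trans (by gcongr)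
  calc _ ≤ C * ((M.aForm U w w).re + 4 * R ^ 2 * (δ⁻¹ * (M.aForm U w w).re)) := by gcongr
    _ = _ := by ring

end Medium

end FormProperties

/-! ### Finite energy solutions -/

/-- The pullback of a sesquilinear form. -/
def pullForm {X Y : Type*} [NormedAddCommGroup X] [NormedSpace ℂ X] [NormedAddCommGroup Y]
    [NormedSpace ℂ Y] (b : Y →L⋆[ℂ] Y →L[ℂ] ℂ) (L : X →L[ℂ] Y) : X →L⋆[ℂ] X →L[ℂ] ℂ :=
  (ContinuousLinearMap.precomp ℂ L) ∘SL (b ∘SL L)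

namespace Medium

variable {n : ℕ} {U V : Set (E n)} (M : Medium n)

/-- The Dirichlet form on `H_D(U)`. -/
def aFormHD (U : Set (E n)) : HD U →L⋆[ℂ] HD U →L[ℂ] ℂ := pullForm (M.aForm U) (HD U).subtypeL

theorem aFormHD_apply (w η : HD U) : M.aFormHD U w η = M.aForm U w η := rfl

theorem conj_aFormHD (w η : HD U) : conj (M.aFormHD U η w) = M.aFormHD U w η := M.conj_aForm _ _

theorem re_aFormHD_nonneg (w : HD U) : 0 ≤ (M.aFormHD U w w).re := M.re_aForm_nonneg _

theorem exists_aFormHD_coercive (hn : 0 < n) (hb : Bornology.IsBounded U) :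
    ∃ δ, 0 < δ ∧ ∀ w : HD U, δ * ‖w‖ ^ 2 ≤ (M.aFormHD U w w).re := by
  obtain ⟨δ, hδ, hc⟩ := M.exists_aForm_coercive hn hb
  exact ⟨δ, hδ, fun w => hc w w.2⟩

/-- The form `a + h` on `H_D(U)`. -/
def bFormHD (U : Set (E n)) : HD U →L⋆[ℂ] HD U →L[ℂ] ℂ :=
  M.aFormHD U + pullForm (M.hForm U) (fnHD U)

theorem bFormHD_apply (w η : HD U) :
    M.bFormHD U w η = M.aFormHD U w η + M.hForm U (fnHD U w) (fnHD U η) := rfl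

theorem conj_bFormHD (w η : HD U) : conj (M.bFormHD U η w) = M.bFormHD U w η := by
  rw [bFormHD_apply, bFormHD_apply, map_add, conj_aFormHD, conj_hForm]

/-- The mass form controls the `L²` term of the Gårding inequality, so no boundedness of `U` is
required; this is what makes `U = ℝⁿ` accessible. -/
theorem exists_bFormHD_coercive (U : Set (E n)) :
    ∃ δ, 0 < δ ∧ ∀ w : HD U, δ * ‖w‖ ^ 2 ≤ (M.bFormHD U w w).re := by
  obtain ⟨δ, hδ, hh⟩ := M.exists_hForm_lower
  obtain ⟨C, hC, hb⟩ := M.exists_norm_H1_sq_le U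
  refine ⟨(C * (1 + δ⁻¹))⁻¹, by positivity, fun w => ?_⟩
  rw [inv_mul_eq_div, div_le_iff₀ (by positivity)]
  refine (hb w).trans ?_
  rw [bFormHD_apply, Complex.add_re, aFormHD_apply]
  have h1 := M.re_aForm_nonneg (w : H1 U)
  have h2 : ‖fn (w : H1 U)‖ ^ 2 ≤ δ⁻¹ * (M.hForm U (fnHD U w) (fnHD U w)).re := by
    rw [inv_mul_eq_div, le_div_iff₀ hδ, mul_comm]
    exact hh U (fnHD U w)
  have h3 : 0 ≤ (M.hForm U (fnHD U w) (fnHD U w)).re :=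
    le_trans (by positivity) (hh U (fnHD U w))
  generalize (M.aForm U (w : H1 U) w).re = α at *
  generalize (M.hForm U (fnHD U w) (fnHD U w)).re = β at *
  generalize ‖fn (w : H1 U)‖ ^ 2 = γ at *
  have h5 : 0 ≤ δ⁻¹ * α := by positivity
  have h6 : α + γ ≤ (α + β) * (1 + δ⁻¹) := by linarith
  calc _ ≤ C * ((α + β) * (1 + δ⁻¹)) := mul_le_mul_of_nonneg_left h6 hC.le
    _ = _ := by ring

variable {M}

theorem IsWave.sub {T : ℝ} {u v : ℝ → H1 U × L2 U} (hu : M.IsWave U T u) (hv : M.IsWave U T v) :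
    M.IsWave U T (fun t => u t - v t) where
  continuousOn := hu.continuousOn.sub hv.continuousOn
  hasDeriv t ht := (hu.hasDeriv t ht).sub (hv.hasDeriv t ht)
  equation η hη t ht := by
    have h1 := (hu.equation η hη t ht).sub (hv.equation η hη t ht)
    have e1 : (fun s => M.pairing (u s - v s).2 η)
        = (fun s => M.pairing (u s).2 η) - fun s => M.pairing (v s).2 η := by
      funext s
      simp only [M.pairing_eq _ hη, Pi.sub_apply, Prod.snd_sub, map_sub]
    have e2 : -M.form (u t - v t).1 η = -M.form (u t).1 η - -M.form (v t).1 η := by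
      simp only [M.form_eq _ hη, Prod.fst_sub, map_sub]
      ring
    rw [e1, e2]
    exact h1

theorem pairing_restrict (h : V ⊆ U) (v : L2 U) {η : E n → ℂ} (hη : IsTestFunction V η) :
    M.pairing (L2.restrict h v) η = M.pairing v η := by
  have e : ∀ {W : Set (E n)} (v : L2 W), M.pairing v η
      = ∫ x in W, v x * ((((M.c x ^ 2)⁻¹ * M.vol x : ℝ) : ℂ) * conj (η x)) := by
    intro W v
    refine integral_congr_ae (ae_of_all _ fun x => ?_)
    simp only
    ring
  rw [e, e]
  refine L2.integral_restrict_mul h v fun x hx => hη.supp (subset_tsupport _ fun h0 => hx ?_)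
  simp only [h0, map_zero, mul_zero]

/-- Locality: the density vanishes wherever `η` and its derivatives do, hence outside `V`. -/
theorem form_restrict (h : V ⊆ U) (w : H1 U) {η : E n → ℂ} (hη : IsTestFunction V η) :
    M.form (H1.restrict h w) η = M.form w η := by
  have hz : ∀ x, x ∉ V → M.density x (fn w x) (fun j => grad w j x) (η x)
      (fun j => pderiv j η x) * (M.vol x : ℂ) = 0 := by
    intro x hx
    have h0 : η x = 0 := by
      by_contra hne
      exact hx (hη.supp (subset_tsupport _ hne))
    have h1 : ∀ j, pderiv j η x = 0 := fun j => by
      by_contra hne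
      exact hx (hη.supp (support_pderiv_subset j hne))
    simp [density, D, h0, h1]
  have e : M.form w η = ∫ x in V, M.density x (fn w x) (fun j => grad w j x) (η x)
      (fun j => pderiv j η x) * (M.vol x : ℂ) := by
    rw [form, setIntegral_eq_integral_of_forall_compl_eq_zero hz,
      setIntegral_eq_integral_of_forall_compl_eq_zero fun x hx => hz x fun hV => hx (h hV)]
  rw [e, form]
  refine integral_congr_ae ?_
  filter_upwards [L2.coeFn_restrict h (fn w),
    ae_all_iff.2 fun j => L2.coeFn_restrict h (grad w j)] with x h1 h2
  have h3 : fn (H1.restrict h w) x = fn w x := h1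
  have h4 : ∀ j, grad (H1.restrict h w) j x = grad w j x := h2
  simp only [h3, h4]

theorem IsWave.restrict {T : ℝ} {u : ℝ → H1 U × L2 U} (hu : M.IsWave U T u) (h : V ⊆ U) :
    M.IsWave V T (fun t => (H1.restrictL h (u t).1, L2.restrictL h (u t).2)) where
  continuousOn := ((H1.restrictL h).continuous.comp_continuousOn hu.continuousOn.fst).prodMk
    ((L2.restrictL h).continuous.comp_continuousOn hu.continuousOn.snd)
  hasDeriv t ht := ((L2.restrictL h).restrictScalars ℝ).hasFDerivAt.comp_hasDerivWithinAt t
    (hu.hasDeriv t ht)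
  equation η hη t ht := by
    simp only [L2.restrictL_apply, H1.restrictL_apply, pairing_restrict h _ hη,
      form_restrict h _ hη]
    exact hu.equation η ⟨hη.smooth, hη.compact, hη.supp.trans h⟩ t ht

theorem energy_restrict (h : V ⊆ U) (w : H1 U) (v : L2 U) :
    M.energy V (w, v) = M.energy V (H1.restrictL h w, L2.restrictL h v) := by
  refine integral_congr_ae ?_
  filter_upwards [L2.coeFn_restrict h (fn w), L2.coeFn_restrict h v,
    ae_all_iff.2 fun j => L2.coeFn_restrict h (grad w j)] with x h1 h1' h2
  have h3 : fn (H1.restrictL h w) x = fn w x := h1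
  have h4 : ∀ j, grad (H1.restrictL h w) j x = grad w j x := h2
  have h5 : L2.restrictL h v x = v x := h1'
  simp only [h3, h4, h5]

/-- Abstract solutions with values in `H_D(U)` are finite energy solutions. -/
theorem isWave_of_abstract {u : ℝ → HD U} {v : ℝ → L2 U} (hu : Continuous u) (hv : Continuous v)
    (h1 : ∀ t, HasDerivAt (fun s => fnHD U (u s)) (v t) t)
    (h2 : ∀ η t, HasDerivAt (fun s => M.hForm U (fnHD U η) (v s)) (-M.aFormHD U η (u t)) t)
    (T t₀ : ℝ) : M.IsWave U T (fun t => ((u (t - t₀) : H1 U), v (t - t₀))) where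
  continuousOn := ((continuous_subtype_val.comp (hu.comp (continuous_sub_right t₀))).prodMk
    (hv.comp (continuous_sub_right t₀))).continuousOn
  hasDeriv t _ := ((h1 (t - t₀)).comp_sub_const t t₀).hasDerivWithinAt
  equation η hη t _ := by
    simp only [M.pairing_eq _ hη, M.form_eq _ hη]
    exact (h2 ⟨ofTest hη, ofTest_mem_HD hη⟩ (t - t₀)).comp_sub_const t t₀

theorem dense_tests : Dense {w : HD U | ∃ η, ∃ hη : IsTestFunction U η, (w : H1 U) = ofTest hη} := by
  intro w
  rw [closure_subtype]
  refine closure_mono ?_ (HD_subset_closure w.2)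
  rintro _ ⟨η, hη, rfl⟩
  exact ⟨⟨ofTest hη, ofTest_mem_HD hη⟩, ⟨η, hη, rfl⟩, rfl⟩

/-- Abstract uniqueness with test functions as the dense set. The time `t₀` is free: it is `0` for
the Cauchy problem and `T` for time reversal. -/
theorem IsWave.eq_zero (hU : IsOpen U) {T t₀ : ℝ} (ht₀ : t₀ ∈ Icc 0 T) {w : ℝ → H1 U × L2 U}
    (hw : M.IsWave U T w) (hHD : ∀ t ∈ Icc 0 T, (w t).1 ∈ HD U) (h0 : w t₀ = 0) :
    ∀ t ∈ Icc 0 T, w t = 0 := by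
  classical
  -- Membership in `HD U` is known only on `[0, T]`; the value `0` elsewhere is irrelevant.
  set u : ℝ → HD U := fun t => if h : (w t).1 ∈ HD U then ⟨(w t).1, h⟩ else 0 with hu
  have hue : ∀ t ∈ Icc 0 T, (u t : H1 U) = (w t).1 := fun t ht => by
    rw [hu]; simp only [dif_pos (hHD t ht)]
  have huc : ContinuousOn u (Icc 0 T) := by
    rw [Topology.IsInducing.subtypeVal.continuousOn_iff]
    exact hw.continuousOn.fst.congr hue
  obtain ⟨δ, hδ, hh⟩ := M.exists_hForm_lower
  have key := wave_eq_zero (V := HD U) (H := L2 U) (ι := fnHD U) (fnHD_injective hU) (M.aFormHD U) M.conj_aFormHD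
    M.re_aFormHD_nonneg (M.hForm U) M.conj_hForm
    (fun x hx => lt_of_lt_of_le (mul_pos hδ (pow_pos (norm_pos_iff.2 hx) 2)) (hh U x)) ht₀
    (u := u) (v := fun t => (w t).2) huc hw.continuousOn.snd
    (Subtype.ext ((hue t₀ ht₀).trans (by rw [h0]; rfl))) (by rw [h0]; rfl)
    (fun t ht => (hw.hasDeriv t ht).congr (fun s hs => by
      change fn (u s : H1 U) = _
      rw [hue s hs]) (by
      change fn (u t : H1 U) = _
      rw [hue t ht])) (dense_tests (U := U)) (by
      rintro η ⟨ψ, hψ, hηψ⟩ t ht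
      have h1 := hw.equation ψ hψ t ht
      simp only [M.pairing_eq _ hψ, M.form_eq _ hψ, ← hηψ] at h1
      rw [← hue t (Ioo_subset_Icc_self ht)] at h1
      exact h1)
  intro t ht
  obtain ⟨h1, h2⟩ := key t ht
  refine Prod.ext ?_ h2
  rw [← hue t ht, h1]
  rfl

/-! ### The Cauchy problem -/

theorem exists_isCauchySolution {Ω : Set (E n)} (hΩ : MeasurableSet Ω) (T : ℝ) {f : H1 Ω}
    (hf : f ∈ HD Ω) : ∃ u, M.IsCauchySolution Ω T f u := by
  obtain ⟨f', hf', he⟩ := exists_extension hΩ hf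
  obtain ⟨δ, hδ, hh⟩ := M.exists_hForm_lower
  obtain ⟨δ', hδ', hb⟩ := M.exists_bFormHD_coercive univ
  obtain ⟨u, v, huc, hvc, hu0, hv0, h1, h2⟩ := exists_wave_of_coercive_add
    (V := HD (univ : Set (E n))) (H := L2 (univ : Set (E n))) (ι := fnHD univ)
    (fnHD_injective isOpen_univ) (denseRange_fnHD isOpen_univ) (M.aFormHD univ) (M.bFormHD univ)
    M.conj_bFormHD hδ' hb M.re_aFormHD_nonneg (M.hForm univ) M.conj_hForm hδ (hh univ)
    M.bFormHD_apply ⟨f', hf'⟩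
  refine ⟨fun t => ((u (t - 0) : H1 univ), v (t - 0)),
    isWave_of_abstract huc hvc h1 h2 T 0, fun t _ => (u (t - 0)).2, ?_, ?_⟩
  · refine ae_univ_iff.1 ?_
    have h3 : fn (u (0 - 0) : H1 (univ : Set (E n))) = L2.extendL hΩ (fn f) := by
      rw [sub_zero, hu0]; exact he
    simp only [h3]
    exact L2.coeFn_extend hΩ (fn f)
  · simp only [sub_zero, hv0]

/-- The initial condition fixes only the function, but that determines its weak derivatives too. -/
theorem IsCauchySolution.eqOn {Ω : Set (E n)} {T : ℝ} (hT : 0 ≤ T) {f : H1 Ω}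
    {u u' : ℝ → H1 (univ : Set (E n)) × L2 (univ : Set (E n))} (hu : M.IsCauchySolution Ω T f u)
    (hu' : M.IsCauchySolution Ω T f u') : EqOn u u' (Icc 0 T) := by
  have h0 : u 0 - u' 0 = 0 := by
    rw [sub_eq_zero]
    refine Prod.ext (fn_injective isOpen_univ (Lp.ext ?_))
      (hu.initial_deriv.trans hu'.initial_deriv.symm)
    exact ae_univ_iff.2 (hu.initial.trans hu'.initial.symm)
  intro t ht
  exact sub_eq_zero.1 ((hu.wave.sub hu'.wave).eq_zero isOpen_univ (left_mem_Icc.2 hT)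
    (fun s hs => sub_mem (hu.mem_HD s hs) (hu'.mem_HD s hs)) h0 t ht)

theorem IsCauchySolution.restrict_initial {Ω : Set (E n)} (hΩ : IsOpen Ω) {T : ℝ} {f : H1 Ω}
    {u : ℝ → H1 (univ : Set (E n)) × L2 (univ : Set (E n))} (hu : M.IsCauchySolution Ω T f u) :
    H1.restrictL (subset_univ Ω) (u 0).1 = f := by
  refine fn_injective hΩ (Lp.ext ?_)
  have h1 : (fn (u 0).1 : E n → ℂ) =ᵐ[volume.restrict Ω] Ω.indicator (fn f) :=
    ae_restrict_of_ae hu.initial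
  filter_upwards [L2.coeFn_restrict (subset_univ Ω) (fn (u 0).1), h1,
    ae_restrict_mem hΩ.measurableSet] with x h2 h3 h4
  rw [indicator_of_mem h4] at h3
  exact h2.trans h3

/-! ### The time reversed problem -/

theorem trace_eq_iff {w w' : H1 U} : trace w = trace w' ↔ w - w' ∈ HD U :=
  Submodule.Quotient.eq _

theorem IsTimeReversal.eqOn {Ω : Set (E n)} (hn : 0 < n) (hΩ : IsOpen Ω)
    (hb : Bornology.IsBounded Ω) {T : ℝ} (hT : 0 ≤ T) {h : ℝ → BoundaryValues Ω} {v v' : ℝ → H1 Ω × L2 Ω}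
    (hv : M.IsTimeReversal Ω T h v) (hv' : M.IsTimeReversal Ω T h v') : EqOn v v' (Icc 0 T) := by
  have hHD : ∀ t ∈ Icc 0 T, (v t - v' t).1 ∈ HD Ω := fun t ht =>
    trace_eq_iff.1 ((hv.boundary t ht).trans (hv'.boundary t ht).symm)
  have h0 : v T - v' T = 0 := by
    refine Prod.ext ?_ (sub_eq_zero.2 (hv.final_deriv.trans hv'.final_deriv.symm))
    set d := (v T - v' T).1 with hd
    have hdm : d ∈ HD Ω := hHD T (right_mem_Icc.2 hT)
    -- The two final states are `P`-harmonic with the same boundary values, so their difference lies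
    -- in `HD Ω` and is orthogonal to it; coercivity makes it vanish.
    have h1 : HD Ω ≤ LinearMap.ker (M.aForm Ω d : H1 Ω →ₗ[ℂ] ℂ) := by
      refine HD_le (M.aForm Ω d).isClosed_ker fun η hη => ?_
      have h2 := hv.final.equation η hη
      have h3 := hv'.final.equation η hη
      rw [M.form_eq _ hη] at h2 h3
      change M.aForm Ω d (ofTest hη) = 0
      rw [← M.conj_aForm, hd, Prod.fst_sub, map_sub, h2, h3, sub_zero, map_zero]
    have h4 : M.aForm Ω d d = 0 := h1 hdm
    obtain ⟨δ, hδ, hc⟩ := M.exists_aForm_coercive hn hb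
    have h5 := hc d hdm
    rw [h4, Complex.zero_re] at h5
    by_contra hne
    have : 0 < ‖d‖ := norm_pos_iff.2 hne
    have : 0 < δ * ‖d‖ ^ 2 := by positivity
    linarith
  intro t ht
  exact sub_eq_zero.1 ((hv.wave.sub hv'.wave).eq_zero hΩ (right_mem_Icc.2 hT) hHD h0 t ht)

/-- The time reversed solution with the boundary values of a wave `u`, with the energy estimate
for the error at the initial time. -/
theorem exists_isTimeReversal {Ω : Set (E n)} (hn : 0 < n) (hΩ : IsOpen Ω)
    (hb : Bornology.IsBounded Ω) {T : ℝ} {u : ℝ → H1 Ω × L2 Ω} (hu : M.IsWave Ω T u) :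
    ∃ v, M.IsTimeReversal Ω T (fun t => trace (u t).1) v ∧ (u 0).1 - (v 0).1 ∈ HD Ω ∧
      M.dirichlet Ω ((u 0).1 - (v 0).1) ≤ M.energy Ω (u T) := by
  obtain ⟨δ, hδ, hc⟩ := M.exists_aFormHD_coercive hn hb
  obtain ⟨δ', hδ', hh⟩ := M.exists_hForm_lower
  -- `ψ` is the orthogonal projection of `u(T)` onto `H_D(Ω)` in the Dirichlet form; `u(T) - ψ` is
  -- then the required harmonic extension `φ`.
  obtain ⟨ψ, hψ⟩ := exists_representative_of_coercive (V := HD Ω) (M.aFormHD Ω) M.conj_aFormHD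
    hδ hc (M.aForm Ω (u T).1 ∘L (HD Ω).subtypeL)
  obtain ⟨w, z, hwc, hzc, hw0, hz0, h1, h2, h3⟩ := exists_wave_of_coercive (V := HD Ω)
    (H := L2 Ω) (ι := fnHD Ω) (fnHD_injective hΩ)
    (denseRange_fnHD hΩ) (M.aFormHD Ω) M.conj_aFormHD hδ hc
    (M.hForm Ω) M.conj_hForm hδ' (hh Ω) ψ (u T).2
  have hψ' : ∀ η ∈ HD Ω, M.aForm Ω ((u T).1 - ψ) η = 0 := fun η hη => by
    have h4 : M.aForm Ω (ψ : H1 Ω) η = M.aForm Ω (u T).1 η := hψ ⟨η, hη⟩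
    rw [map_sub, sub_apply, h4, sub_self]
  -- The orbit with data `(ψ, u_t(T))` is shifted so that these are its values at `t = T`.
  -- Subtracting it keeps the boundary values of `u`, leaves `φ` at time `T` and cancels the
  -- velocity there.
  refine ⟨fun t => u t - ((w (t - T) : H1 Ω), z (t - T)),
    ⟨hu.sub (isWave_of_abstract hwc hzc h1 h2 T T), fun t _ => ?_, ⟨fun η hη => ?_, ?_⟩, ?_⟩, ?_, ?_⟩
  · rw [trace_eq_iff, Prod.fst_sub, sub_sub_cancel_left]
    exact neg_mem (w (t - T)).2
  · rw [M.form_eq _ hη, sub_self, hw0, ← M.conj_aForm]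
    exact (congrArg _ (hψ' _ (ofTest_mem_HD hη))).trans (map_zero _)
  · rw [trace_eq_iff, Prod.fst_sub, sub_sub_cancel_left]
    exact neg_mem (w (T - T)).2
  · simp only [sub_self, hz0, Prod.snd_sub]
  · rw [Prod.fst_sub, sub_sub_cancel]
    exact (w (0 - T)).2
  · rw [Prod.fst_sub, sub_sub_cancel, ← (M.re_aForm_self _).1, M.energy_eq]
    -- Conservation of energy between the final time and `t = 0`.
    have h4 := h3 (0 - T)
    have h5 : 0 ≤ (M.hForm Ω (z (0 - T)) (z (0 - T))).re := le_trans (by positivity) (hh _ _)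
    have h6 : (M.aForm Ω (u T).1 (u T).1).re
        -- Pythagoras for `u(T) = φ + ψ`; dropping the nonnegative Dirichlet integral of `φ` gives
        -- the inequality.
        = (M.aForm Ω ((u T).1 - ψ) ((u T).1 - ψ)).re + (M.aForm Ω (ψ : H1 Ω) ψ).re := by
      have h7 := hψ' ψ ψ.2
      have h8 : M.aForm Ω (ψ : H1 Ω) ((u T).1 - ψ) = 0 := by
        rw [← M.conj_aForm, h7, map_zero]
      have h9 : M.aForm Ω (u T).1 (u T).1 = M.aForm Ω (((u T).1 - ψ) + ψ) (((u T).1 - ψ) + ψ) := by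
        rw [sub_add_cancel]
      rw [h9, map_add, map_add, add_apply, add_apply, h7, h8, add_zero, zero_add, Complex.add_re]
    have h10 := M.re_aForm_nonneg ((u T).1 - (ψ : H1 Ω))
    rw [aFormHD_apply, aFormHD_apply] at h4
    linarith

end Medium

end Thermoacoustic

end

/-! ### The error estimate for the time reversal -/

open Thermoacoustic in
theorem corollary2p1 (n : ℕ) (hn : 0 < n) (M : Medium n) (Ω : Set (E n))
    (hΩ : IsSmoothBoundedDomain Ω) (T : ℝ) (hT : 0 < T)
    (f : H1 Ω) (hf : f ∈ HD Ω) (hf0 : f ≠ 0) :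
    -- the Cauchy problem defining `u` and `Λ f` is uniquely solvable
    (∃ u, M.IsCauchySolution Ω T f u) ∧
    (∀ u u', M.IsCauchySolution Ω T f u → M.IsCauchySolution Ω T f u' → Set.EqOn u u' (Set.Icc 0 T)) ∧
    -- the time reversed problem defining `A Λ f` is uniquely solvable
    (∃ v, M.IsTimeReversal Ω T (M.Lam Ω T f) v) ∧
    (∀ v v', M.IsTimeReversal Ω T (M.Lam Ω T f) v → M.IsTimeReversal Ω T (M.Lam Ω T f) v' →
      Set.EqOn v v' (Set.Icc 0 T)) ∧
    -- the error estimate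
    f - M.A Ω T (M.Lam Ω T f) ∈ HD Ω ∧
    ∀ u, M.IsCauchySolution Ω T f u →
      0 < M.energy Ω (u 0) ∧
      M.normHD (f - M.A Ω T (M.Lam Ω T f)) ≤
        (M.energy Ω (u T) / M.energy Ω (u 0)) ^ (1 / 2 : ℝ) * M.normHD f := by
  have hex := Medium.exists_isCauchySolution (M := M) hΩ.isOpen.measurableSet T hf
  have huniq : ∀ v v', M.IsTimeReversal Ω T (M.Lam Ω T f) v →
      M.IsTimeReversal Ω T (M.Lam Ω T f) v' → Set.EqOn v v' (Set.Icc 0 T) := fun v v' hv hv' =>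
    hv.eqOn hn hΩ.isOpen hΩ.isBounded hT.le hv'
  set u₀ := Classical.epsilon (M.IsCauchySolution Ω T f) with hu₀
  have hu₀s : M.IsCauchySolution Ω T f u₀ := Classical.epsilon_spec hex
  obtain ⟨v, hv, hv1, hv2⟩ := Medium.exists_isTimeReversal hn hΩ.isOpen hΩ.isBounded
    (hu₀s.wave.restrict (subset_univ Ω))
  replace hv : M.IsTimeReversal Ω T (M.Lam Ω T f) v := hv
  -- The solution selected in the definition of `A` agrees with the constructed one on `[0, T]` by
  -- uniqueness.
  have hA : M.A Ω T (M.Lam Ω T f) = (v 0).1 :=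
    congrArg Prod.fst (huniq _ _ (Classical.epsilon_spec ⟨v, hv⟩) hv (left_mem_Icc.2 hT.le))
  simp only [hu₀s.restrict_initial hΩ.isOpen] at hv1 hv2
  refine ⟨hex, fun u u' hu hu' => hu.eqOn hT.le hu', ⟨v, hv⟩, huniq, by rwa [hA], fun u hu => ?_⟩
  -- On `Ω` the initial state is `(f, 0)`, so there is no kinetic part.
  have hE0 : M.energy Ω (u 0) = M.dirichlet Ω f := by
    have h1 : u 0 = ((u 0).1, 0) := Prod.ext rfl hu.initial_deriv
    rw [h1, Medium.energy_restrict (subset_univ Ω), hu.restrict_initial hΩ.isOpen, map_zero,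
      M.energy_eq, map_zero, Complex.zero_re, add_zero, (M.re_aForm_self f).1]
  have hET : M.dirichlet Ω (f - M.A Ω T (M.Lam Ω T f)) ≤ M.energy Ω (u T) := by
    rw [hA, hu.eqOn hT.le hu₀s (right_mem_Icc.2 hT.le)]
    exact hv2.trans_eq (Medium.energy_restrict (subset_univ Ω) (u₀ T).1 (u₀ T).2).symm
  have hpos : 0 < M.dirichlet Ω f := by
    obtain ⟨δ, hδ, hc⟩ := M.exists_aForm_coercive hn hΩ.isBounded
    rw [← (M.re_aForm_self f).1]
    exact lt_of_lt_of_le (mul_pos hδ (pow_pos (norm_pos_iff.2 hf0) 2)) (hc f hf)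
  have hnn : 0 ≤ M.energy Ω (u T) := by
    refine le_trans ?_ hET
    rw [← (M.re_aForm_self _).1]
    exact M.re_aForm_nonneg _
  rw [hE0]
  refine ⟨hpos, ?_⟩
  -- The right side collapses to the square root of `E_Ω(u,T)`, as `E_Ω(u,0)` is the squared norm of
  -- `f`.
  rw [← Real.sqrt_eq_rpow, Medium.normHD, Medium.normHD, ← Real.sqrt_mul (by positivity),
    div_mul_cancel₀ _ hpos.ne']
  exact Real.sqrt_le_sqrt hET
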